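/- For a smooth real-valued function $S$ on $\mathbf{R}^n$ and a smooth, compactly supported, real-valued function $\phi$ on $\mathbf{R}^n$, let $J_{S,\phi}(\lambda)=\int_{\mathbf{R}^n}e^{i\lambda S(x)}\phi(x)\,dx$. Suppose that there are a neighborhood $U_0$ of the origin, an increasing arithmetic progression $s_0<s_1<\cdots$ of positive rational numbers independent of $\phi$, and complex coefficients $d_{ij}(\phi)$ such that for every smooth real-valued $\phi$ with compact support in $U_0$ $$J_{S,\phi}(\lambda)\sim\sum_{j=0}^{\infty}\sum_{i=0}^{n-1}d_{ij}(\phi)\,\ln(\lambda)^i\,\lambda^{-s_j}\qquad(\lambda\to+\infty),$$ that is, for every $N$ the difference of $J_{S,\phi}(\lambda)$ and the sum of the terms with $j\le N$ is $o(\lambda^{-s_N})$. The oscillation index of $S$ at the origin is then the least $s_j$ such that for every neighborhood $U\subseteq U_0$ of the origin, $d_{ij}(\phi)\neq0$ for some $i$ and some smooth real-valued $\phi$ with compact support in $U$. **Theorem 1.8.** For $t\in\mathbf{R}$ let $V_t(x,y,z)=(x^4+tx^2+y^2+z^2)^2$ on $\mathbf{R}^3$. The integrals $J_{V_t,\phi}$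 have such an asymptotic expansion near the origin, and (a) if $t>0$, the oscillation index of $V_t$ at the origin is $\tfrac34$; (b) the oscillation index of $V_0$ at the origin is $\tfrac58$; (c) if $t<0$, the oscillation index of $V_t$ at the origin is $\tfrac12$. -/

import Mathlib

open scoped ContDiff Topology

/- Throughout, `Fin n → ℝ` is the space `ℝⁿ`; only its topology, its smooth functions and its
Lebesgue measure `volume` are used, and none of these depends on the choice of a norm. -/

/-- `φ` is a smooth real-valued function with compact support contained in `U`. -/
def IsAmplitude {n : ℕ} (U : Set (Fin n → ℝ)) (φ : (Fin n → ℝ) → ℝ) : Prop :=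
  ContDiff ℝ ∞ φ ∧ HasCompactSupport φ ∧ tsupport φ ⊆ U

/-- The oscillatory integral `J_{S,φ}(l) = ∫ exp(i l S(x)) φ(x) dx` over `ℝⁿ`. -/
noncomputable def oscillatoryIntegral {n : ℕ} (S φ : (Fin n → ℝ) → ℝ) (l : ℝ) : ℂ :=
  ∫ x : Fin n → ℝ, Complex.exp (Complex.I * ((l * S x : ℝ) : ℂ)) * ((φ x : ℝ) : ℂ)

/-- `s 0 < s 1 < …` is an increasing arithmetic progression of positive rational numbers. -/
def IsExponentProgression (s : ℕ → ℚ) : Prop :=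
  ∃ a b : ℚ, 0 < a ∧ 0 < b ∧ ∀ j : ℕ, s j = a + j * b

/-- For every smooth `φ` compactly supported in `U`, one has the asymptotic expansion
`J_{S,φ}(l) ∼ ∑_{j ≥ 0} ∑_{0 ≤ i ≤ n - 1} d_{ij}(φ) (ln l)^i l^{-s_j}` as `l → +∞`: after
subtracting all terms with exponents `s_0, …, s_N`, the remainder is `o(l^{-s_N})`, for each `N`.
The exponents do not depend on `φ`. -/
def HasOscillatoryExpansion {n : ℕ} (S : (Fin n → ℝ) → ℝ) (U : Set (Fin n → ℝ)) (s : ℕ → ℚ)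
    (d : ℕ → ℕ → ((Fin n → ℝ) → ℝ) → ℂ) : Prop :=
  ∀ φ : (Fin n → ℝ) → ℝ, IsAmplitude U φ → ∀ N : ℕ,
    (fun l : ℝ => oscillatoryIntegral S φ l -
        ∑ j ∈ Finset.range (N + 1), ∑ i ∈ Finset.range n,
          d i j φ * ((Real.log l ^ i * l ^ (-(s j : ℝ)) : ℝ) : ℂ))
      =o[Filter.atTop] (fun l : ℝ => l ^ (-(s N : ℝ)))

/-- `β` is the oscillation index of `S` at the origin: on some neighborhood `U₀` of the origin the
oscillatory integrals with phase `S` have an asymptotic expansion as above, and `β` is the least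
exponent `s_j` such that for every neighborhood `U ⊆ U₀` of the origin some coefficient
`d_{ij}(φ)`, with `φ` supported in `U`, is nonzero. (The coefficients of an asymptotic expansion
are determined by the integral, so that it does not matter which `U₀`, `s`, `d` are used.) -/
def IsOscillationIndex {n : ℕ} (S : (Fin n → ℝ) → ℝ) (β : ℝ) : Prop :=
  ∃ U₀ ∈ 𝓝 (0 : Fin n → ℝ), ∃ (s : ℕ → ℚ) (d : ℕ → ℕ → ((Fin n → ℝ) → ℝ) → ℂ),
    IsExponentProgression s ∧ HasOscillatoryExpansion S U₀ s d ∧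
    IsLeast {r : ℝ | ∃ j : ℕ, r = (s j : ℝ) ∧
      ∀ U ∈ 𝓝 (0 : Fin n → ℝ), U ⊆ U₀ →
        ∃ φ : (Fin n → ℝ) → ℝ, IsAmplitude U φ ∧ ∃ i < n, d i j φ ≠ 0} β

/-- The phase `V_t(x, y, z) = (x⁴ + t x² + y² + z²)²` on `ℝ³`. -/
def phaseV (t : ℝ) (p : Fin 3 → ℝ) : ℝ :=
  (p 0 ^ 4 + t * p 0 ^ 2 + p 1 ^ 2 + p 2 ^ 2) ^ 2

/-!
# Oscillation indices of the phases `V_t(x, y, z) = (x⁴ + t x² + y² + z²)²`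

Integrating over angles in the `(y, z)`-plane leaves an integral over the quadrant `x, ρ > 0` with
phase `(P(x) + ρ²)²`, `P(x) = x⁴ + t x²`, a smooth amplitude and area element `ρ dρ dx`
(`exists_planar_reduction`). For `t ≠ 0` a smooth substitution `x = X(u)` replaces `P` by `± u²`
near the origin (`exists_planar_subst`). Quasi-homogeneous polar coordinates
`(r A(w), r^κ B(w))` then make the phase a monomial: it is `r⁴` for `t > 0`, `r⁸` for `t = 0` and
`w² r⁴` for `t < 0`, and the amplitude carries a factor `r²`, `r⁴` and `r²` respectively
(`exists_monoInt_of_quasiPolar`).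

For a monomial phase `w^p r^q`, integration by parts along the Euler field `r ∂_r` turns
`l d/dl + (m + 1) / q`, applied to the integral with amplitude `r^m G`, into a multiple of the
integral with amplitude `r^(m + 1) ∂_r G` (`eulerEq_monoInt_snd`), and similarly for `w ∂_w`
(`eulerEq_monoInt_fst`). After finitely many such operators the amplitude is divisible by high
powers of `r^q` and `w^p`, so that the integral decays rapidly (`monoInt_isBigO`). Solving the
first-order Euler equations backwards produces the expansion, each equation contributing one
exponent, and a logarithm where exponents coincide (`ExpandsUpTo.of_eulerEq`). The exponents are
`(j + 3) / 4` for `t > 0`, `(j + 5) / 8` for `t = 0`, and `(j + 3) / 4`, `(j + 1) / 2` for `t < 0`.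

It remains to see that the smallest exponent `β` really occurs. If all coefficients at `β`
vanished, the integral would be `o(l^(-β))`. For a nonnegative amplitude `φ`, averaging over
frequencies with the Fejér weight replaces the real part of the oscillating factor by a nonnegative
function of `l V_t` that is at least `1/4` where `l V_t ≤ 1`; so the measure of `{V_t ≤ 1/l}` near
the origin would be `o(l^(-β))` (`not_isLittleO_oscillatoryIntegral`). But this measure is at least of the
order of `l^(-β)`: the set contains boxes (`sublevel_of_pos`, `sublevel_zero`), or for `t < 0` a
layer around the zero surface of `V_t` (`sublevel_of_neg`).
-/

/-! ### Log-power expansions and Euler equations -/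

/-- The function `l ↦ (log l)^i * l^(-b)`, with complex values. -/
noncomputable def logPow (b : ℝ) (i : ℕ) (l : ℝ) : ℂ :=
  ((Real.log l ^ i * l ^ (-b) : ℝ) : ℂ)

/-- The finite linear combinations of the functions `logPow b i` with `i < m b`: the exponent `b`
occurs with multiplicity at most `m b`. -/
noncomputable def logPowSpan (m : ℝ → ℕ) : Submodule ℂ (ℝ → ℂ) :=
  Submodule.span ℂ {f | ∃ b i, i < m b ∧ f = logPow b i}

/-- `F` agrees with an element of `logPowSpan m` up to `O(l^(-M))` as `l → ∞`. -/
def ExpandsUpTo (m : ℝ → ℕ) (M : ℝ) (F : ℝ → ℂ) : Prop :=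
  ∃ g ∈ logPowSpan m, (fun l => F l - g l) =O[Filter.atTop] fun l : ℝ => l ^ (-M)

/-- The Euler equation `l G'(l) + a G(l) = H(l)` on the half-line `l > 0`. -/
def EulerEq (a : ℂ) (G H : ℝ → ℂ) : Prop :=
  ∀ l : ℝ, 0 < l → HasDerivAt G ((H l - a * G l) / l) l

theorem EulerEq.add {a : ℂ} {G H G' H' : ℝ → ℂ} (h : EulerEq a G H) (h' : EulerEq a G' H') :
    EulerEq a (G + G') (H + H') := by
  intro l hl
  refine ((h l hl).add (h' l hl)).congr_deriv ?_
  simp only [Pi.add_apply]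
  ring

theorem EulerEq.const_smul {a : ℂ} {G H : ℝ → ℂ} (h : EulerEq a G H) (c : ℂ) :
    EulerEq a (c • G) (c • H) := by
  intro l hl
  refine ((h l hl).const_smul c).congr_deriv ?_
  simp only [Pi.smul_apply, smul_eq_mul]
  ring

theorem eulerEq_zero (a : ℂ) : EulerEq a 0 0 := by
  intro l hl
  simp [hasDerivAt_zero]

theorem eulerEq_logPow_succ (a b : ℝ) (i : ℕ) :
    EulerEq a (logPow b (i + 1))
      (((a - b : ℝ) : ℂ) • logPow b (i + 1) + ((i + 1 : ℕ) : ℂ) • logPow b i) := by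
  intro l hl
  have h1 : HasDerivAt (fun l : ℝ => Real.log l ^ (i + 1) * l ^ (-b))
      (((i + 1 : ℕ) * Real.log l ^ i * l⁻¹) * l ^ (-b) +
        Real.log l ^ (i + 1) * (-b * l ^ (-b - 1))) l := by
    have := ((Real.hasDerivAt_log hl.ne').pow (i + 1)).mul
      (Real.hasDerivAt_rpow_const (p := -b) (Or.inl hl.ne'))
    exact this.congr_deriv (by simp)
  refine h1.ofReal_comp.congr_deriv ?_
  have hl' : (l : ℂ) ≠ 0 := by exact_mod_cast hl.ne'
  rw [Real.rpow_sub_one hl.ne']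
  simp only [Pi.add_apply, Pi.smul_apply, smul_eq_mul, logPow]
  push_cast
  field_simp
  ring

theorem eulerEq_logPow_zero (a b : ℝ) :
    EulerEq a (logPow b 0) (((a - b : ℝ) : ℂ) • logPow b 0) := by
  intro l hl
  have h1 : HasDerivAt (fun l : ℝ => Real.log l ^ 0 * l ^ (-b)) (-b * l ^ (-b - 1)) l := by
    simpa using Real.hasDerivAt_rpow_const (p := -b) (Or.inl hl.ne')
  refine h1.ofReal_comp.congr_deriv ?_
  have hl' : (l : ℂ) ≠ 0 := by exact_mod_cast hl.ne'
  rw [Real.rpow_sub_one hl.ne']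
  simp only [Pi.smul_apply, smul_eq_mul, logPow]
  push_cast
  field_simp
  ring

theorem logPow_mem_logPowSpan {m : ℝ → ℕ} {b : ℝ} {i : ℕ} (h : i < m b) :
    logPow b i ∈ logPowSpan m :=
  Submodule.subset_span ⟨b, i, h, rfl⟩

theorem logPowSpan_mono {m m' : ℝ → ℕ} (h : m ≤ m') : logPowSpan m ≤ logPowSpan m' := by
  refine Submodule.span_mono ?_
  rintro _ ⟨b, i, hi, rfl⟩
  exact ⟨b, i, hi.trans_le (h b), rfl⟩

theorem exists_eulerEq_logPow {m : ℝ → ℕ} {a b : ℝ} (hab : a ≠ b) :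
    ∀ i, i < m b → ∃ g ∈ logPowSpan m, EulerEq a g (logPow b i) := by
  have hab' : ((a - b : ℝ) : ℂ) ≠ 0 := by exact_mod_cast sub_ne_zero.2 hab
  intro i
  induction i with
  | zero =>
    intro h
    refine ⟨_, Submodule.smul_mem _ ((a - b : ℝ) : ℂ)⁻¹ (logPow_mem_logPowSpan h), ?_⟩
    have := (eulerEq_logPow_zero a b).const_smul ((a - b : ℝ) : ℂ)⁻¹
    rwa [smul_smul, inv_mul_cancel₀ hab', one_smul] at this
  | succ i ih =>
    intro h
    obtain ⟨g, hg, hg'⟩ := ih (by omega)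
    refine ⟨((a - b : ℝ) : ℂ)⁻¹ • (logPow b (i + 1) + (-((i + 1 : ℕ) : ℂ)) • g),
      Submodule.smul_mem _ _ (Submodule.add_mem _ (logPow_mem_logPowSpan h)
        (Submodule.smul_mem _ _ hg)), ?_⟩
    have := ((eulerEq_logPow_succ a b i).add (hg'.const_smul (-((i + 1 : ℕ) : ℂ)))).const_smul
      ((a - b : ℝ) : ℂ)⁻¹
    rwa [neg_smul _ (logPow b i), add_neg_cancel_right, smul_smul,
      inv_mul_cancel₀ hab', one_smul] at this

/-- Solving an Euler equation raises the multiplicity of the exponent `a` by one: at resonance the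
solution has one more logarithm. -/
theorem exists_eulerEq_of_mem {m m' : ℝ → ℕ} {a : ℝ} (hm : m ≤ m') (ha : m a + 1 ≤ m' a)
    {h : ℝ → ℂ} (hh : h ∈ logPowSpan m) : ∃ g ∈ logPowSpan m', EulerEq a g h := by
  induction hh using Submodule.span_induction with
  | mem x hx =>
    obtain ⟨b, i, hi, rfl⟩ := hx
    by_cases hab : a = b
    · subst hab
      have h0 : ((i + 1 : ℕ) : ℂ) ≠ 0 := by exact_mod_cast i.succ_ne_zero
      refine ⟨_, Submodule.smul_mem _ ((i + 1 : ℕ) : ℂ)⁻¹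
        (logPow_mem_logPowSpan (i := i + 1) (b := a) (by omega)), ?_⟩
      have := (eulerEq_logPow_succ a a i).const_smul ((i + 1 : ℕ) : ℂ)⁻¹
      rwa [sub_self, Complex.ofReal_zero, zero_smul, zero_add, smul_smul, inv_mul_cancel₀ h0,
        one_smul] at this
    · exact exists_eulerEq_logPow hab i (hi.trans_le (hm b))
  | zero => exact ⟨0, Submodule.zero_mem _, eulerEq_zero _⟩
  | add x y _ _ hx hy =>
    obtain ⟨g, hg, hg'⟩ := hx
    obtain ⟨k, hk, hk'⟩ := hy
    exact ⟨g + k, Submodule.add_mem _ hg hk, hg'.add hk'⟩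
  | smul c x _ hx =>
    obtain ⟨g, hg, hg'⟩ := hx
    exact ⟨c • g, Submodule.smul_mem _ _ hg, hg'.const_smul c⟩

/-- If `|D'| ≤ C l^(e-1)` on `[L, ∞)` then the increments of `D` are those of `(C/e) l^e`. -/
theorem norm_sub_le_of_deriv_le_rpow {D D' : ℝ → ℂ} {C e L : ℝ} (he : e ≠ 0) (hL : 0 < L)
    (hD : ∀ l, L ≤ l → HasDerivAt D (D' l) l) (hb : ∀ l, L ≤ l → ‖D' l‖ ≤ C * l ^ (e - 1))
    {x y : ℝ} (hx : L ≤ x) (hxy : x ≤ y) : ‖D y - D x‖ ≤ C / e * (y ^ e - x ^ e) := by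
  have := image_norm_le_of_norm_deriv_right_le_deriv_boundary' (a := x) (b := y)
    (f := fun l => D l - D x) (f' := D') (B := fun l => C / e * (l ^ e - x ^ e))
    (B' := fun l => C * l ^ (e - 1))
    (fun l hl => ((hD l (hx.trans hl.1)).continuousAt.sub continuousAt_const).continuousWithinAt)
    (fun l hl => ((hD l (hx.trans hl.1)).sub_const _).hasDerivWithinAt) (by simp)
    (fun l hl => ?_) (fun l hl => ?_) (fun l hl => hb l (hx.trans hl.1))
    (Set.right_mem_Icc.2 hxy)
  · exact this
  · have hl0 : l ≠ 0 := (hL.trans_le (hx.trans hl.1)).ne'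
    exact (((Real.continuousAt_rpow_const l e (Or.inl hl0)).sub
      continuousAt_const).const_mul _).continuousWithinAt
  · have hl0 : l ≠ 0 := (hL.trans_le (hx.trans hl.1)).ne'
    have := ((Real.hasDerivAt_rpow_const (p := e) (Or.inl hl0)).sub_const (x ^ e)).const_mul (C / e)
    refine (this.congr_deriv ?_).hasDerivWithinAt
    field_simp

open Filter Asymptotics in
/-- An approximate solution of the homogeneous Euler equation is, up to the order of the error,
a multiple of `l^(-a)`. -/
theorem eulerEq_isBigO {a M : ℝ} (haM : a ≠ M) {G H : ℝ → ℂ} (h : EulerEq a G H)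
    (hH : H =O[atTop] fun l : ℝ => l ^ (-M)) :
    ∃ c : ℂ, (fun l => G l - c * logPow a 0 l) =O[atTop] fun l : ℝ => l ^ (-M) := by
  obtain ⟨C, hC⟩ := hH.bound
  obtain ⟨L₀, hL₀⟩ := eventually_atTop.1 hC
  set L := max L₀ 1
  have hL : 0 < L := lt_of_lt_of_le one_pos (le_max_right _ _)
  set D : ℝ → ℂ := fun l => ((l ^ a : ℝ) : ℂ) * G l
  set D' : ℝ → ℂ := fun l => ((l ^ (a - 1) : ℝ) : ℂ) * H l
  have hD : ∀ l, L ≤ l → HasDerivAt D (D' l) l := by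
    intro l hl
    have hl0 : 0 < l := hL.trans_le hl
    have hl' : (l : ℂ) ≠ 0 := by exact_mod_cast hl0.ne'
    have := (Real.hasDerivAt_rpow_const (p := a) (Or.inl hl0.ne')).ofReal_comp.mul (h l hl0)
    refine this.congr_deriv ?_
    simp only [D']
    rw [Real.rpow_sub_one hl0.ne']
    push_cast
    field_simp
    ring
  have he : a - M ≠ 0 := sub_ne_zero.2 haM
  have hb : ∀ l, L ≤ l → ‖D' l‖ ≤ C * l ^ (a - M - 1) := by
    intro l hl
    have hl0 : 0 < l := hL.trans_le hl
    have h1 := hL₀ l ((le_max_left _ _).trans hl)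
    rw [Real.norm_of_nonneg (Real.rpow_nonneg hl0.le _)] at h1
    simp only [D', norm_mul, Complex.norm_real, Real.norm_of_nonneg (Real.rpow_nonneg hl0.le _)]
    calc l ^ (a - 1) * ‖H l‖ ≤ l ^ (a - 1) * (C * l ^ (-M)) :=
          mul_le_mul_of_nonneg_left h1 (Real.rpow_nonneg hl0.le _)
      _ = C * l ^ (a - M - 1) := by
          rw [mul_left_comm, ← Real.rpow_add hl0]; ring_nf
  have key : ∀ x y, L ≤ x → x ≤ y → ‖D y - D x‖ ≤ C / (a - M) * (y ^ (a - M) - x ^ (a - M)) :=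
    fun x y hx hxy => norm_sub_le_of_deriv_le_rpow he hL hD hb hx hxy
  -- It suffices to approximate `D` by a constant up to `O(l^(a-M))`.
  suffices hs : ∃ c : ℂ, ∃ K : ℝ, ∀ l, L ≤ l → ‖D l - c‖ ≤ K * l ^ (a - M) by
    obtain ⟨c, K, hK⟩ := hs
    refine ⟨c, IsBigO.of_bound K (eventually_atTop.2 ⟨L, fun l hl => ?_⟩)⟩
    have hl0 : 0 < l := hL.trans_le hl
    have hG : G l - c * logPow a 0 l = ((l ^ (-a) : ℝ) : ℂ) * (D l - c) := by
      have : ((l ^ (-a) : ℝ) : ℂ) * ((l ^ a : ℝ) : ℂ) = 1 := by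
        rw [← Complex.ofReal_mul, ← Real.rpow_add hl0]; simp
      simp only [D, logPow, pow_zero, one_mul, mul_sub, ← mul_assoc, this]
      ring
    rw [hG, norm_mul, Complex.norm_real, Real.norm_of_nonneg (Real.rpow_nonneg hl0.le _),
      Real.norm_of_nonneg (Real.rpow_nonneg hl0.le _)]
    calc l ^ (-a) * ‖D l - c‖ ≤ l ^ (-a) * (K * l ^ (a - M)) :=
          mul_le_mul_of_nonneg_left (hK l hl) (Real.rpow_nonneg hl0.le _)
      _ = K * l ^ (-M) := by rw [mul_left_comm, ← Real.rpow_add hl0]; ring_nf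
  rcases lt_or_gt_of_ne haM with hlt | hgt
  · have ht : Tendsto (fun y : ℝ => y ^ (a - M)) atTop (𝓝 0) := by
      have := tendsto_rpow_neg_atTop (y := M - a) (by linarith)
      simpa using this
    have hcau : CauchySeq (fun n : ℕ => D (n + L)) := by
      have hS : Tendsto (fun n : ℕ => ((n : ℝ) + L) ^ (a - M)) atTop (𝓝 0) :=
        ht.comp (tendsto_atTop_add_const_right _ _ tendsto_natCast_atTop_atTop)
      have hS' : Tendsto (fun n : ℕ => C / (M - a) * ((n : ℝ) + L) ^ (a - M)) atTop (𝓝 0) := by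
        simpa using hS.const_mul (C / (M - a))
      have hC0 : 0 ≤ C := by
        have h1 := (norm_nonneg _).trans (hb L le_rfl)
        exact nonneg_of_mul_nonneg_left h1 (Real.rpow_pos_of_pos hL _)
      refine cauchySeq_of_le_tendsto_0' _ (fun n k hnk => ?_) hS'
      rw [dist_comm, dist_eq_norm]
      have hn0 : (0 : ℝ) ≤ n := n.cast_nonneg
      have hk0 : (0 : ℝ) ≤ k := k.cast_nonneg
      have hnk' : (n : ℝ) ≤ k := by exact_mod_cast hnk
      refine (key (n + L) (k + L) (by linarith) (by linarith)).trans ?_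
      have h2 : 0 ≤ C / (M - a) * ((k : ℝ) + L) ^ (a - M) :=
        mul_nonneg (div_nonneg hC0 (by linarith)) (Real.rpow_nonneg (by linarith) _)
      have h3 : C / (a - M) = - (C / (M - a)) := by
        rw [← neg_sub M a, div_neg]
      rw [h3]
      linarith
    obtain ⟨c, hc⟩ := cauchySeq_tendsto_of_complete hcau
    refine ⟨c, C / (M - a), fun l hl => ?_⟩
    have hS : Tendsto (fun n : ℕ => ((n : ℝ) + L) ^ (a - M)) atTop (𝓝 0) :=
      ht.comp (tendsto_atTop_add_const_right _ _ tendsto_natCast_atTop_atTop)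
    have h1 : Tendsto (fun n : ℕ => ‖D (n + L) - D l‖) atTop (𝓝 ‖c - D l‖) :=
      (hc.sub_const _).norm
    have h2 : Tendsto (fun n : ℕ => C / (a - M) * (((n : ℝ) + L) ^ (a - M) - l ^ (a - M))) atTop
        (𝓝 (C / (a - M) * (0 - l ^ (a - M)))) := (hS.sub_const _).const_mul _
    have h3 := le_of_tendsto_of_tendsto h1 h2 ?_
    · rw [norm_sub_rev]
      refine h3.trans_eq ?_
      rw [← neg_sub M a, div_neg]; ring
    · filter_upwards [eventually_ge_atTop ⌈l⌉₊] with n hn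
      refine key l (n + L) hl ?_
      have := Nat.ceil_le.1 hn
      linarith
  · refine ⟨D L, C / (a - M), fun l hl => (key L l le_rfl hl).trans ?_⟩
    have hC0 : 0 ≤ C := by
      have h1 := (norm_nonneg _).trans (hb L le_rfl)
      exact nonneg_of_mul_nonneg_left h1 (Real.rpow_pos_of_pos hL _)
    have : 0 ≤ C / (a - M) := div_nonneg hC0 (by linarith)
    exact mul_le_mul_of_nonneg_left (by linarith [Real.rpow_nonneg hL.le (a - M)]) this

/-- The expansion of the right side of an Euler equation passes to its solutions, at the cost of
one more power of the logarithm at the exponent `a`. -/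
theorem ExpandsUpTo.of_eulerEq {m m' : ℝ → ℕ} {a M : ℝ} (hm : m ≤ m') (ha : m a + 1 ≤ m' a)
    (haM : a ≠ M) {F H : ℝ → ℂ} (h : EulerEq a F H) (hH : ExpandsUpTo m M H) :
    ExpandsUpTo m' M F := by
  obtain ⟨g, hg, hgH⟩ := hH
  obtain ⟨k, hk, hkg⟩ := exists_eulerEq_of_mem hm ha hg
  have h1 : EulerEq a (F + (-1 : ℂ) • k) (H + (-1 : ℂ) • g) := h.add (hkg.const_smul _)
  obtain ⟨c, hc⟩ := eulerEq_isBigO (M := M) haM h1 (by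
    refine hgH.congr_left fun l => ?_
    simp [sub_eq_add_neg])
  refine ⟨k + c • logPow a 0, Submodule.add_mem _ hk (Submodule.smul_mem _ _
    (logPow_mem_logPowSpan (by omega))), hc.congr_left fun l => ?_⟩
  simp only [Pi.add_apply, Pi.smul_apply, smul_eq_mul]
  ring

theorem ExpandsUpTo.of_isBigO {m : ℝ → ℕ} {M : ℝ} {F : ℝ → ℂ}
    (h : F =O[Filter.atTop] fun l : ℝ => l ^ (-M)) : ExpandsUpTo m M F :=
  ⟨0, Submodule.zero_mem _, by simpa using h⟩

theorem ExpandsUpTo.add {m : ℝ → ℕ} {M : ℝ} {F G : ℝ → ℂ} (hF : ExpandsUpTo m M F)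
    (hG : ExpandsUpTo m M G) : ExpandsUpTo m M (F + G) := by
  obtain ⟨f, hf, hf'⟩ := hF
  obtain ⟨g, hg, hg'⟩ := hG
  refine ⟨f + g, Submodule.add_mem _ hf hg, (hf'.add hg').congr_left fun l => ?_⟩
  simp only [Pi.add_apply]
  ring

theorem ExpandsUpTo.const_smul {m : ℝ → ℕ} {M : ℝ} {F : ℝ → ℂ} (hF : ExpandsUpTo m M F) (c : ℂ) :
    ExpandsUpTo m M (c • F) := by
  obtain ⟨f, hf, hf'⟩ := hF
  refine ⟨c • f, Submodule.smul_mem _ _ hf, (hf'.const_mul_left c).congr_left fun l => ?_⟩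
  simp only [Pi.smul_apply, smul_eq_mul]
  ring

theorem ExpandsUpTo.mono {m m' : ℝ → ℕ} {M : ℝ} {F : ℝ → ℂ} (hF : ExpandsUpTo m M F)
    (h : m ≤ m') : ExpandsUpTo m' M F := by
  obtain ⟨f, hf, hf'⟩ := hF
  exact ⟨f, logPowSpan_mono h hf, hf'⟩

/-! ### Oscillatory integrals with a monomial phase -/

/-- The oscillating factor `exp(i l w^p r^q)`. -/
noncomputable def monoExp (p q : ℕ) (l w r : ℝ) : ℂ :=
  Complex.exp (Complex.I * ((l * (w ^ p * r ^ q) : ℝ) : ℂ))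

/-- The oscillatory integral over `(w, r) ∈ [a, b] × [0, R]` with phase `w^p r^q` and
amplitude `G`. -/
noncomputable def monoInt (p q : ℕ) (a b R : ℝ) (G : ℝ × ℝ → ℂ) (l : ℝ) : ℂ :=
  ∫ w in a..b, ∫ r in (0 : ℝ)..R, monoExp p q l w r * G (w, r)

/-- `G` is a smooth function of `(w, r)` that vanishes for `r ≥ R`. -/
def SmoothBelow (R : ℝ) (G : ℝ × ℝ → ℂ) : Prop :=
  ContDiff ℝ ∞ G ∧ ∀ w r, R ≤ r → G (w, r) = 0

/-- The partial derivative in the first variable. -/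
noncomputable def partialFst (G : ℝ × ℝ → ℂ) (z : ℝ × ℝ) : ℂ := fderiv ℝ G z (1, 0)

/-- The partial derivative in the second variable. -/
noncomputable def partialSnd (G : ℝ × ℝ → ℂ) (z : ℝ × ℝ) : ℂ := fderiv ℝ G z (0, 1)

theorem continuous_monoExp (p q : ℕ) :
    Continuous fun z : ℝ × ℝ × ℝ => monoExp p q z.1 z.2.1 z.2.2 := by
  unfold monoExp
  fun_prop

theorem norm_monoExp (p q : ℕ) (l w r : ℝ) : ‖monoExp p q l w r‖ = 1 := by
  rw [monoExp, mul_comm, Complex.norm_exp_ofReal_mul_I]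

theorem hasDerivAt_partialFst {G : ℝ × ℝ → ℂ} (hG : ContDiff ℝ ∞ G) (w r : ℝ) :
    HasDerivAt (fun w => G (w, r)) (partialFst G (w, r)) w := by
  have h1 : HasFDerivAt G (fderiv ℝ G (w, r)) (w, r) :=
    (hG.differentiable (by simp) (w, r)).hasFDerivAt
  exact h1.comp_hasDerivAt w ((hasDerivAt_id w).prodMk (hasDerivAt_const w r))

theorem hasDerivAt_partialSnd {G : ℝ × ℝ → ℂ} (hG : ContDiff ℝ ∞ G) (w r : ℝ) :
    HasDerivAt (fun r => G (w, r)) (partialSnd G (w, r)) r := by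
  have h1 : HasFDerivAt G (fderiv ℝ G (w, r)) (w, r) :=
    (hG.differentiable (by simp) (w, r)).hasFDerivAt
  exact h1.comp_hasDerivAt r ((hasDerivAt_const r w).prodMk (hasDerivAt_id r))

theorem contDiff_fderiv_const_apply {G : ℝ × ℝ → ℂ} (hG : ContDiff ℝ ∞ G) (v : ℝ × ℝ) :
    ContDiff ℝ ∞ fun z => fderiv ℝ G z v :=
  (hG.fderiv_right (m := ∞) (by simp)).clm_apply contDiff_const

namespace SmoothBelow

variable {R : ℝ} {G : ℝ × ℝ → ℂ}

theorem partialFst (h : SmoothBelow R G) : SmoothBelow R (partialFst G) := by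
  refine ⟨contDiff_fderiv_const_apply h.1 _, fun w r hr => ?_⟩
  have h1 := hasDerivAt_partialFst h.1 w r
  have h2 : (fun w => G (w, r)) = fun _ => 0 := funext fun w => h.2 w r hr
  rw [h2] at h1
  exact h1.unique (hasDerivAt_const _ _)

theorem partialSnd (h : SmoothBelow R G) : SmoothBelow R (partialSnd G) := by
  refine ⟨contDiff_fderiv_const_apply h.1 _, fun w r hr => ?_⟩
  have h1 := (hasDerivAt_partialSnd h.1 w r).hasDerivWithinAt (s := Set.Ici r)
  have h2 : HasDerivWithinAt (fun r => G (w, r)) 0 (Set.Ici r) r :=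
    (hasDerivWithinAt_const r (Set.Ici r) (0 : ℂ)).congr (fun s hs => h.2 w s (hr.trans hs))
      (h.2 w r hr)
  exact (uniqueDiffOn_Ici r r Set.self_mem_Ici).eq_deriv _ h1 h2

theorem fst_pow_mul (h : SmoothBelow R G) (k : ℕ) :
    SmoothBelow R fun z => (z.1 : ℂ) ^ k * G z := by
  refine ⟨?_, fun w r hr => by simp [h.2 w r hr]⟩
  exact ((Complex.ofRealCLM.contDiff.comp contDiff_fst).pow k).mul h.1

theorem snd_pow_mul (h : SmoothBelow R G) (k : ℕ) :
    SmoothBelow R fun z => (z.2 : ℂ) ^ k * G z := by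
  refine ⟨?_, fun w r hr => by simp [h.2 w r hr]⟩
  exact ((Complex.ofRealCLM.contDiff.comp contDiff_snd).pow k).mul h.1

theorem comp_const_fst (h : SmoothBelow R G) (b : ℝ) : SmoothBelow R fun z => G (b, z.2) :=
  ⟨h.1.comp (contDiff_const.prodMk contDiff_snd), fun _ r hr => h.2 b r hr⟩

end SmoothBelow

theorem continuous_monoInt_integrand (p q : ℕ) {G : ℝ × ℝ → ℂ} (hG : Continuous G) :
    Continuous fun z : ℝ × ℝ × ℝ => monoExp p q z.1 z.2.1 z.2.2 * G z.2 :=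
  (continuous_monoExp p q).mul (hG.comp continuous_snd)

theorem continuous_monoInt_inner (p q : ℕ) (R : ℝ) {G : ℝ × ℝ → ℂ} (hG : Continuous G) :
    Continuous fun z : ℝ × ℝ => ∫ r in (0 : ℝ)..R, monoExp p q z.1 z.2 r * G (z.2, r) := by
  refine intervalIntegral.continuous_parametric_intervalIntegral_of_continuous' ?_ 0 R
  exact (continuous_monoInt_integrand p q hG).comp
    (f := fun y : (ℝ × ℝ) × ℝ => (y.1.1, y.1.2, y.2)) (by fun_prop)

section linear

variable (p q : ℕ) (a b R : ℝ) {G H : ℝ × ℝ → ℂ}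

theorem monoInt_add (hG : Continuous G) (hH : Continuous H) (l : ℝ) :
    monoInt p q a b R (fun z => G z + H z) l = monoInt p q a b R G l + monoInt p q a b R H l := by
  unfold monoInt
  rw [← intervalIntegral.integral_add]
  · refine intervalIntegral.integral_congr fun w _ => ?_
    simp only [mul_add]
    refine intervalIntegral.integral_add ?_ ?_
    · exact Continuous.intervalIntegrable ((continuous_monoInt_integrand p q hG).comp
        (f := fun r : ℝ => (l, w, r)) (by fun_prop)) _ _
    · exact Continuous.intervalIntegrable ((continuous_monoInt_integrand p q hH).comp
        (f := fun r : ℝ => (l, w, r)) (by fun_prop)) _ _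
  · exact Continuous.intervalIntegrable ((continuous_monoInt_inner p q R hG).comp
      (f := fun w : ℝ => (l, w)) (by fun_prop)) _ _
  · exact Continuous.intervalIntegrable ((continuous_monoInt_inner p q R hH).comp
      (f := fun w : ℝ => (l, w)) (by fun_prop)) _ _

theorem monoInt_const_mul (c : ℂ) (G : ℝ × ℝ → ℂ) (l : ℝ) :
    monoInt p q a b R (fun z => c * G z) l = c * monoInt p q a b R G l := by
  unfold monoInt
  rw [← intervalIntegral.integral_const_mul]
  refine intervalIntegral.integral_congr fun w _ => ?_
  rw [← intervalIntegral.integral_const_mul]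
  refine intervalIntegral.integral_congr fun r _ => ?_
  ring

end linear

/-- Differentiation under an interval integral, for a jointly continuous derivative. -/
theorem hasDerivAt_intervalIntegral_of_continuous {f f' : ℝ → ℝ → ℂ} (a b : ℝ)
    (hf : Continuous fun z : ℝ × ℝ => f z.1 z.2) (hf' : Continuous fun z : ℝ × ℝ => f' z.1 z.2)
    (h : ∀ l w, HasDerivAt (fun l => f l w) (f' l w) l) (l : ℝ) :
    HasDerivAt (fun l => ∫ w in a..b, f l w) (∫ w in a..b, f' l w) l := by
  have hK : IsCompact (Set.Icc (l - 1) (l + 1) ×ˢ Set.uIcc a b) :=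
    isCompact_Icc.prod isCompact_uIcc
  obtain ⟨C, hC⟩ := hK.exists_bound_of_continuousOn hf'.continuousOn
  refine (intervalIntegral.hasDerivAt_integral_of_dominated_loc_of_deriv_le
    (s := Set.Icc (l - 1) (l + 1)) (bound := fun _ => C) (F' := f')
    (Icc_mem_nhds (by linarith) (by linarith))
    (Filter.Eventually.of_forall fun x => ?_) ?_ ?_ ?_ intervalIntegrable_const ?_).2
  · exact (hf.comp (f := fun w : ℝ => (x, w)) (by fun_prop)).aestronglyMeasurable
  · exact (hf.comp (f := fun w : ℝ => (l, w)) (by fun_prop)).intervalIntegrable _ _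
  · exact (hf'.comp (f := fun w : ℝ => (l, w)) (by fun_prop)).aestronglyMeasurable
  · exact Filter.Eventually.of_forall fun w hw x hx =>
      hC (x, w) ⟨hx, Set.uIoc_subset_uIcc hw⟩
  · exact Filter.Eventually.of_forall fun w _ x _ => h x w

theorem hasDerivAt_monoExp (p q : ℕ) (l w r : ℝ) :
    HasDerivAt (fun l => monoExp p q l w r)
      (monoExp p q l w r * (Complex.I * ((w : ℂ) ^ p * (r : ℂ) ^ q))) l := by
  have h1 : HasDerivAt (fun l : ℝ => ((l * (w ^ p * r ^ q) : ℝ) : ℂ))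
      ((w ^ p * r ^ q : ℝ) : ℂ) l := by
    simpa using ((hasDerivAt_id l).mul_const (w ^ p * r ^ q)).ofReal_comp
  refine ((h1.const_mul Complex.I).cexp).congr_deriv ?_
  simp [monoExp]

theorem hasDerivAt_monoExp_snd (p q : ℕ) (l w r : ℝ) :
    HasDerivAt (fun r => monoExp p q l w r)
      (monoExp p q l w r * (Complex.I * (l * (w : ℂ) ^ p * (q * (r : ℂ) ^ (q - 1))))) r := by
  have h1 : HasDerivAt (fun r : ℝ => ((l * (w ^ p * r ^ q) : ℝ) : ℂ))
      ((l * (w ^ p * (q * r ^ (q - 1))) : ℝ) : ℂ) r :=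
    (((hasDerivAt_pow q r).const_mul (w ^ p)).const_mul l).ofReal_comp
  refine ((h1.const_mul Complex.I).cexp).congr_deriv ?_
  simp [monoExp]
  ring

theorem hasDerivAt_monoExp_fst (p q : ℕ) (l w r : ℝ) :
    HasDerivAt (fun w => monoExp p q l w r)
      (monoExp p q l w r * (Complex.I * (l * (p * (w : ℂ) ^ (p - 1)) * (r : ℂ) ^ q))) w := by
  have h1 : HasDerivAt (fun w : ℝ => ((l * (w ^ p * r ^ q) : ℝ) : ℂ))
      ((l * (p * w ^ (p - 1) * r ^ q) : ℝ) : ℂ) w :=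
    (((hasDerivAt_pow p w).mul_const (r ^ q)).const_mul l).ofReal_comp
  refine ((h1.const_mul Complex.I).cexp).congr_deriv ?_
  simp [monoExp]
  ring

theorem hasDerivAt_monoInt (p q : ℕ) (a b R : ℝ) {G : ℝ × ℝ → ℂ} (hG : Continuous G) (l : ℝ) :
    HasDerivAt (monoInt p q a b R G)
      (monoInt p q a b R (fun z => Complex.I * ((z.1 : ℂ) ^ p * (z.2 : ℂ) ^ q) * G z) l) l := by
  have hG' : Continuous fun z : ℝ × ℝ => Complex.I * ((z.1 : ℂ) ^ p * (z.2 : ℂ) ^ q) * G z := by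
    fun_prop
  refine hasDerivAt_intervalIntegral_of_continuous
    (f := fun l w => ∫ r in (0 : ℝ)..R, monoExp p q l w r * G (w, r))
    (f' := fun l w => ∫ r in (0 : ℝ)..R,
      monoExp p q l w r * (Complex.I * ((w : ℂ) ^ p * (r : ℂ) ^ q) * G (w, r)))
    a b (continuous_monoInt_inner p q R hG)
    (continuous_monoInt_inner p q R hG') (fun l w => ?_) l
  refine hasDerivAt_intervalIntegral_of_continuous
    (f := fun l r => monoExp p q l w r * G (w, r))
    (f' := fun l r => monoExp p q l w r * (Complex.I * ((w : ℂ) ^ p * (r : ℂ) ^ q) * G (w, r))) 0 R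
    ?_ ?_ (fun l r => ?_) l
  · exact (continuous_monoInt_integrand p q hG).comp
      (f := fun y : ℝ × ℝ => (y.1, w, y.2)) (by fun_prop)
  · exact (continuous_monoInt_integrand p q hG').comp
      (f := fun y : ℝ × ℝ => (y.1, w, y.2)) (by fun_prop)
  · refine ((hasDerivAt_monoExp p q l w r).mul_const (G (w, r))).congr_deriv ?_
    ring

/-- Integration by parts in `r`: the integral of `∂_r (exp(i l w^p r^q) r^(m+1) G)` is zero. -/
theorem monoInt_parts_snd (p : ℕ) {q : ℕ} (hq : 1 ≤ q) (a b : ℝ) {R : ℝ} {G : ℝ × ℝ → ℂ}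
    (hG : SmoothBelow R G) (m : ℕ) (l : ℝ) :
    q * (Complex.I * l * monoInt p q a b R (fun z => (z.1 : ℂ) ^ p * (z.2 : ℂ) ^ (q + m) * G z) l) +
      ((m + 1) * monoInt p q a b R (fun z => (z.2 : ℂ) ^ m * G z) l +
        monoInt p q a b R (fun z => (z.2 : ℂ) ^ (m + 1) * partialSnd G z) l) = 0 := by
  have hGc := hG.1.continuous
  have hGc' := hG.partialSnd.1.continuous
  rw [← mul_assoc (q : ℂ), ← monoInt_const_mul, ← monoInt_const_mul, ← monoInt_add p q a b R,
    ← monoInt_add p q a b R]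
  rotate_left
  · fun_prop
  · fun_prop
  · fun_prop
  · fun_prop
  unfold monoInt
  refine (intervalIntegral.integral_congr (g := fun _ => (0 : ℂ)) fun w _ => ?_).trans (by simp)
  simp only
  have hd : ∀ r : ℝ, HasDerivAt
      (fun r : ℝ => monoExp p q l w r * ((r : ℂ) ^ (m + 1) * G (w, r)))
      (monoExp p q l w r * (q * (Complex.I * l) * ((w : ℂ) ^ p * (r : ℂ) ^ (q + m) * G (w, r)) +
        ((m + 1) * ((r : ℂ) ^ m * G (w, r)) + (r : ℂ) ^ (m + 1) * partialSnd G (w, r)))) r := by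
    intro r
    have h1 : HasDerivAt (fun r : ℝ => (r : ℂ) ^ (m + 1)) ((m + 1 : ℕ) * (r : ℂ) ^ m) r := by
      simpa using (hasDerivAt_pow (m + 1) (r : ℂ)).comp_ofReal
    refine ((hasDerivAt_monoExp_snd p q l w r).mul
      (h1.mul (hasDerivAt_partialSnd hG.1 w r))).congr_deriv ?_
    obtain ⟨q, rfl⟩ : ∃ k, q = k + 1 := ⟨q - 1, by omega⟩
    simp only [Nat.add_sub_cancel, Pi.mul_apply]
    push_cast
    ring
  rw [intervalIntegral.integral_eq_sub_of_hasDerivAt (fun r _ => hd r)]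
  · simp [hG.2 w R le_rfl]
  · refine Continuous.intervalIntegrable ?_ _ _
    refine ((continuous_monoExp p q).comp (f := fun r : ℝ => (l, w, r)) (by fun_prop)).mul ?_
    fun_prop

/-- The boundary contribution at `w = c` of an integration by parts in `w`. -/
noncomputable def monoBdry (p q : ℕ) (c R : ℝ) (G : ℝ × ℝ → ℂ) (l : ℝ) : ℂ :=
  ∫ r in (0 : ℝ)..R, monoExp p q l c r * G (c, r)

/-- Integration by parts in `w`, with boundary terms at `w = a` and `w = b`. -/
theorem monoInt_parts_fst {p : ℕ} (hp : 1 ≤ p) (q : ℕ) (a b : ℝ) {R : ℝ} {G : ℝ × ℝ → ℂ}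
    (hG : SmoothBelow R G) (k : ℕ) (l : ℝ) :
    p * (Complex.I * l * monoInt p q a b R (fun z => (z.1 : ℂ) ^ (p + k) * (z.2 : ℂ) ^ q * G z) l) +
      ((k + 1) * monoInt p q a b R (fun z => (z.1 : ℂ) ^ k * G z) l +
        monoInt p q a b R (fun z => (z.1 : ℂ) ^ (k + 1) * partialFst G z) l) =
      monoBdry p q b R (fun z => (z.1 : ℂ) ^ (k + 1) * G z) l -
        monoBdry p q a R (fun z => (z.1 : ℂ) ^ (k + 1) * G z) l := by
  have hGc := hG.1.continuous
  have hGc' := hG.partialFst.1.continuous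
  rw [← mul_assoc (p : ℂ), ← monoInt_const_mul, ← monoInt_const_mul, ← monoInt_add p q a b R,
    ← monoInt_add p q a b R]
  rotate_left
  · fun_prop
  · fun_prop
  · fun_prop
  · fun_prop
  unfold monoInt monoBdry
  rw [MeasureTheory.intervalIntegral_intervalIntegral_swap, ← intervalIntegral.integral_sub]
  rotate_left
  · refine Continuous.intervalIntegrable ?_ _ _
    refine ((continuous_monoExp p q).comp (f := fun r : ℝ => (l, b, r)) (by fun_prop)).mul ?_
    fun_prop
  · refine Continuous.intervalIntegrable ?_ _ _
    refine ((continuous_monoExp p q).comp (f := fun r : ℝ => (l, a, r)) (by fun_prop)).mul ?_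
    fun_prop
  · refine (ContinuousOn.integrableOn_compact (isCompact_uIcc.prod isCompact_uIcc)
      (Continuous.continuousOn ?_)).mono_set
      (Set.prod_mono Set.uIoc_subset_uIcc Set.uIoc_subset_uIcc)
    refine ((continuous_monoExp p q).comp (f := fun z : ℝ × ℝ => (l, z.1, z.2))
      (by fun_prop)).mul ?_
    fun_prop
  refine intervalIntegral.integral_congr fun r _ => ?_
  simp only
  have hd : ∀ w : ℝ, HasDerivAt
      (fun w : ℝ => monoExp p q l w r * ((w : ℂ) ^ (k + 1) * G (w, r)))
      (monoExp p q l w r * (p * (Complex.I * l) * ((w : ℂ) ^ (p + k) * (r : ℂ) ^ q * G (w, r)) +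
        ((k + 1) * ((w : ℂ) ^ k * G (w, r)) + (w : ℂ) ^ (k + 1) * partialFst G (w, r)))) w := by
    intro w
    have h1 : HasDerivAt (fun w : ℝ => (w : ℂ) ^ (k + 1)) ((k + 1 : ℕ) * (w : ℂ) ^ k) w := by
      simpa using (hasDerivAt_pow (k + 1) (w : ℂ)).comp_ofReal
    refine ((hasDerivAt_monoExp_fst p q l w r).mul
      (h1.mul (hasDerivAt_partialFst hG.1 w r))).congr_deriv ?_
    obtain ⟨p, rfl⟩ : ∃ k, p = k + 1 := ⟨p - 1, by omega⟩
    simp only [Nat.add_sub_cancel, Pi.mul_apply]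
    push_cast
    ring
  rw [intervalIntegral.integral_eq_sub_of_hasDerivAt (fun w _ => hd w)]
  refine Continuous.intervalIntegrable ?_ _ _
  refine ((continuous_monoExp p q).comp (f := fun w : ℝ => (l, w, r)) (by fun_prop)).mul ?_
  fun_prop

theorem eulerEq_monoInt_snd (p : ℕ) {q : ℕ} (hq : 1 ≤ q) (a b : ℝ) {R : ℝ} {G : ℝ × ℝ → ℂ}
    (hG : SmoothBelow R G) (m : ℕ) :
    EulerEq (((m + 1 : ℝ) / q : ℝ) : ℂ) (monoInt p q a b R fun z => (z.2 : ℂ) ^ m * G z)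
      ((-(1 / q : ℂ)) • monoInt p q a b R fun z => (z.2 : ℂ) ^ (m + 1) * partialSnd G z) := by
  intro l hl
  refine (hasDerivAt_monoInt p q a b R (hG.snd_pow_mul m).1.continuous l).congr_deriv ?_
  have h := monoInt_parts_snd p hq a b hG m l
  have h2 : (fun z : ℝ × ℝ => Complex.I * ((z.1 : ℂ) ^ p * (z.2 : ℂ) ^ q) * ((z.2 : ℂ) ^ m * G z))
      = fun z => Complex.I * ((z.1 : ℂ) ^ p * (z.2 : ℂ) ^ (q + m) * G z) := by
    funext z; ring
  rw [h2, monoInt_const_mul]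
  have hl' : (l : ℂ) ≠ 0 := by exact_mod_cast hl.ne'
  have hq' : (q : ℂ) ≠ 0 := by exact_mod_cast (by omega : q ≠ 0)
  simp only [Pi.smul_apply, smul_eq_mul]
  push_cast
  field_simp
  linear_combination h

theorem eulerEq_monoInt_fst {p : ℕ} (hp : 1 ≤ p) (q : ℕ) (a b : ℝ) {R : ℝ} {G : ℝ × ℝ → ℂ}
    (hG : SmoothBelow R G) (k : ℕ) :
    EulerEq (((k + 1 : ℝ) / p : ℝ) : ℂ) (monoInt p q a b R fun z => (z.1 : ℂ) ^ k * G z)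
      ((-(1 / p : ℂ)) • ((monoInt p q a b R fun z => (z.1 : ℂ) ^ (k + 1) * partialFst G z) +
        ((-1 : ℂ) • (monoBdry p q b R fun z => (z.1 : ℂ) ^ (k + 1) * G z) +
        monoBdry p q a R fun z => (z.1 : ℂ) ^ (k + 1) * G z))) := by
  intro l hl
  refine (hasDerivAt_monoInt p q a b R (hG.fst_pow_mul k).1.continuous l).congr_deriv ?_
  have h := monoInt_parts_fst hp q a b hG k l
  have h2 : (fun z : ℝ × ℝ => Complex.I * ((z.1 : ℂ) ^ p * (z.2 : ℂ) ^ q) * ((z.1 : ℂ) ^ k * G z))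
      = fun z => Complex.I * ((z.1 : ℂ) ^ (p + k) * (z.2 : ℂ) ^ q * G z) := by
    funext z; ring
  rw [h2, monoInt_const_mul]
  have hl' : (l : ℂ) ≠ 0 := by exact_mod_cast hl.ne'
  have hp' : (p : ℂ) ≠ 0 := by exact_mod_cast (by omega : p ≠ 0)
  simp only [Pi.smul_apply, smul_eq_mul, Pi.add_apply]
  push_cast
  field_simp
  linear_combination h

theorem partialSnd_fst_pow_mul {G : ℝ × ℝ → ℂ} (hG : ContDiff ℝ ∞ G) (k : ℕ) :
    partialSnd (fun z => (z.1 : ℂ) ^ k * G z) = fun z => (z.1 : ℂ) ^ k * partialSnd G z := by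
  funext ⟨w, r⟩
  have hs : ContDiff ℝ ∞ fun z : ℝ × ℝ => (z.1 : ℂ) ^ k * G z :=
    ((Complex.ofRealCLM.contDiff.comp contDiff_fst).pow k).mul hG
  exact (hasDerivAt_partialSnd hs w r).unique
    ((hasDerivAt_partialSnd hG w r).const_mul ((w : ℂ) ^ k))

theorem exists_norm_monoInt_le (p q : ℕ) (a b R : ℝ) {G : ℝ × ℝ → ℂ} (hG : Continuous G) :
    ∃ C, ∀ l, ‖monoInt p q a b R G l‖ ≤ C := by
  have hK : IsCompact (Set.uIcc a b ×ˢ Set.uIcc 0 R) := isCompact_uIcc.prod isCompact_uIcc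
  obtain ⟨C, hC⟩ := hK.exists_bound_of_continuousOn hG.continuousOn
  refine ⟨C * |R - 0| * |b - a|, fun l => ?_⟩
  refine intervalIntegral.norm_integral_le_of_norm_le_const fun w hw => ?_
  refine intervalIntegral.norm_integral_le_of_norm_le_const fun r hr => ?_
  rw [norm_mul, norm_monoExp, one_mul]
  exact hC (w, r) ⟨Set.uIoc_subset_uIcc hw, Set.uIoc_subset_uIcc hr⟩

open Filter Asymptotics in
/-- An amplitude divisible by high powers of `w^p` and `r^q` gives a rapidly decaying integral. -/
theorem monoInt_isBigO (p : ℕ) {q : ℕ} (hq : 1 ≤ q) (a b : ℝ) {R : ℝ} (n : ℕ) :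
    ∀ {K m : ℕ}, p * n ≤ K → q * n ≤ m → ∀ {G : ℝ × ℝ → ℂ}, SmoothBelow R G →
      (monoInt p q a b R fun z => (z.1 : ℂ) ^ K * (z.2 : ℂ) ^ m * G z) =O[atTop]
        fun l : ℝ => l ^ (-(n : ℝ)) := by
  induction n with
  | zero =>
    intro K m _ _ G hG
    have hc : Continuous fun z : ℝ × ℝ => (z.1 : ℂ) ^ K * (z.2 : ℂ) ^ m * G z := by
      have := hG.1.continuous
      fun_prop
    obtain ⟨C, hC⟩ := exists_norm_monoInt_le p q a b R hc
    refine IsBigO.of_bound C (Eventually.of_forall fun l => ?_)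
    simpa using hC l
  | succ n ih =>
    intro K m hK hm G hG
    obtain ⟨K, rfl⟩ : ∃ k, K = p + k := ⟨K - p, by rw [Nat.mul_succ] at hK; omega⟩
    obtain ⟨m, rfl⟩ : ∃ k, m = q + k := ⟨m - q, by rw [Nat.mul_succ] at hm; omega⟩
    have hK' : p * n ≤ K := by rw [Nat.mul_succ] at hK; omega
    have hm' : q * n ≤ m := by rw [Nat.mul_succ] at hm; omega
    have h1 := ih hK' hm' hG
    have h2 := ih hK' (hm'.trans (Nat.le_succ m)) hG.partialSnd
    have hq' : (q : ℂ) ≠ 0 := by exact_mod_cast (by omega : q ≠ 0)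
    have h3 := ((h1.const_mul_left (m + 1 : ℂ)).add h2).const_mul_left (-(1 / (q * Complex.I)))
    have h4 : (fun l : ℝ => ((l : ℂ))⁻¹) =O[atTop] fun l : ℝ => l⁻¹ := by
      refine IsBigO.of_bound 1 (Eventually.of_forall fun l => ?_)
      simp
    refine (h4.mul h3).congr' ?_ ?_
    · filter_upwards [eventually_gt_atTop 0] with l hl
      have hl' : (l : ℂ) ≠ 0 := by exact_mod_cast hl.ne'
      have h := monoInt_parts_snd p hq a b (hG.fst_pow_mul K) m l
      rw [partialSnd_fst_pow_mul hG.1] at h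
      have e1 : (fun z : ℝ × ℝ => (z.1 : ℂ) ^ p * (z.2 : ℂ) ^ (q + m) * ((z.1 : ℂ) ^ K * G z)) =
          fun z => (z.1 : ℂ) ^ (p + K) * (z.2 : ℂ) ^ (q + m) * G z := by funext z; ring
      have e2 : (fun z : ℝ × ℝ => (z.2 : ℂ) ^ m * ((z.1 : ℂ) ^ K * G z)) =
          fun z => (z.1 : ℂ) ^ K * (z.2 : ℂ) ^ m * G z := by funext z; ring
      have e3 : (fun z : ℝ × ℝ => (z.2 : ℂ) ^ (m + 1) * ((z.1 : ℂ) ^ K * partialSnd G z)) =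
          fun z => (z.1 : ℂ) ^ K * (z.2 : ℂ) ^ (m + 1) * partialSnd G z := by funext z; ring
      rw [e1, e2, e3] at h
      field_simp
      linear_combination -h
    · filter_upwards [eventually_gt_atTop 0] with l hl
      rw [← Real.rpow_neg_one, ← Real.rpow_add hl]
      push_cast
      ring_nf

/-! ### Expansion of the integrals with a monomial phase -/

theorem rpow_neg_isBigO_rpow_neg {M N : ℝ} (h : M ≤ N) :
    (fun l : ℝ => l ^ (-N)) =O[Filter.atTop] fun l : ℝ => l ^ (-M) := by
  refine Asymptotics.IsBigO.of_bound 1 ?_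
  filter_upwards [Filter.eventually_ge_atTop 1] with l hl
  rw [one_mul, Real.norm_of_nonneg (by positivity), Real.norm_of_nonneg (by positivity)]
  exact Real.rpow_le_rpow_of_exponent_le hl (by linarith)

open Classical in
/-- The indicator function of the set of exponents `(k + 1) / q` with `k ≥ s`. -/
noncomputable def stepMult (q s : ℕ) (b : ℝ) : ℕ :=
  if ∃ k : ℕ, s ≤ k ∧ b = (k + 1) / q then 1 else 0

theorem stepMult_succ_le (q s : ℕ) : stepMult q (s + 1) ≤ stepMult q s := by
  intro b
  unfold stepMult
  split_ifs with h h'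
  · exact le_rfl
  · obtain ⟨k, hk, hb⟩ := h
    exact absurd ⟨k, by omega, hb⟩ h'
  · exact Nat.zero_le _
  · exact le_rfl

theorem stepMult_self {q : ℕ} (hq : 1 ≤ q) (s : ℕ) :
    stepMult q (s + 1) ((s + 1 : ℝ) / q) + 1 ≤ stepMult q s ((s + 1 : ℝ) / q) := by
  have hq' : (q : ℝ) ≠ 0 := by exact_mod_cast (by omega : q ≠ 0)
  have h1 : stepMult q (s + 1) ((s + 1 : ℝ) / q) = 0 := by
    unfold stepMult
    rw [if_neg]
    rintro ⟨k, hk, hb⟩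
    have : (s : ℝ) = k := by
      field_simp at hb
      linarith
    have : s = k := by exact_mod_cast this
    omega
  have h2 : stepMult q s ((s + 1 : ℝ) / q) = 1 := if_pos ⟨s, le_rfl, rfl⟩
  omega

/-- If amplitudes `r^J G` give integrals that decay like `l^(-M)` up to terms counted by `c`, then
amplitudes `r^s G`, `s ≤ J`, have expansions that also involve the exponents `(k + 1) / q`,
`k ≥ s`. -/
theorem expandsUpTo_of_snd_pow (p : ℕ) {q : ℕ} (hq : 1 ≤ q) (a b R : ℝ) {M : ℝ}
    (hM : ∀ k : ℕ, ((k + 1 : ℝ) / q) ≠ M) (c : ℝ → ℕ) (d : ℕ) : ∀ s : ℕ,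
    (∀ G, SmoothBelow R G →
      ExpandsUpTo c M (monoInt p q a b R fun z => (z.2 : ℂ) ^ (s + d) * G z)) →
    ∀ G, SmoothBelow R G →
      ExpandsUpTo (stepMult q s + c) M (monoInt p q a b R fun z => (z.2 : ℂ) ^ s * G z) := by
  induction d with
  | zero =>
    intro s h G hG
    exact (h G hG).mono (fun b => Nat.le_add_left _ _)
  | succ d ih =>
    intro s h G hG
    have h1 := ih (s + 1) (fun G hG => by
      have := h G hG
      rwa [show s + (d + 1) = s + 1 + d by ring] at this) _ hG.partialSnd
    refine ExpandsUpTo.of_eulerEq (m := stepMult q (s + 1) + c) ?_ ?_ (hM s)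
      (eulerEq_monoInt_snd p hq a b hG s) (h1.const_smul _)
    · exact fun b => Nat.add_le_add_right (stepMult_succ_le q s b) _
    · have := stepMult_self hq s
      simp only [Pi.add_apply]
      omega

open Filter Asymptotics in
theorem monoBdry_isBigO (p : ℕ) {q : ℕ} (hq : 1 ≤ q) {R : ℝ} {c : ℝ} (hc : c ^ p = 1) {n m : ℕ}
    (hm : q * n ≤ m) {G : ℝ × ℝ → ℂ} (hG : SmoothBelow R G) :
    (monoBdry p q c R fun z => (z.2 : ℂ) ^ m * G z) =O[atTop] fun l : ℝ => l ^ (-(n : ℝ)) := by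
  refine (monoInt_isBigO 0 hq 0 1 n (K := 0) (by simp) hm (hG.comp_const_fst c)).congr_left ?_
  intro l
  simp [monoInt, monoBdry, monoExp, hc]

/-- The analogue in the variable `w`; the boundary terms at `w = ±1` are oscillatory integrals in
`r` alone, and they decay because of the factor `r^m`. -/
theorem expandsUpTo_of_fst_pow {p q : ℕ} (hp : 1 ≤ p) (hp2 : Even p) (hq : 1 ≤ q) {R M : ℝ}
    (hM : ∀ k : ℕ, ((k + 1 : ℝ) / p) ≠ M) {n m : ℕ} (hMn : M ≤ n) (hm : q * n ≤ m) (d : ℕ) :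
    ∀ s : ℕ,
    (∀ G, SmoothBelow R G → ExpandsUpTo 0 M
      (monoInt p q (-1) 1 R fun z => (z.1 : ℂ) ^ (s + d) * ((z.2 : ℂ) ^ m * G z))) →
    ∀ G, SmoothBelow R G → ExpandsUpTo (stepMult p s) M
      (monoInt p q (-1) 1 R fun z => (z.1 : ℂ) ^ s * ((z.2 : ℂ) ^ m * G z)) := by
  induction d with
  | zero =>
    intro s h G hG
    exact (h G hG).mono (fun b => Nat.zero_le _)
  | succ d ih =>
    intro s h G hG
    have h1 := ih (s + 1) (fun G hG => by
      have := h G hG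
      rwa [show s + (d + 1) = s + 1 + d by ring] at this) _ hG.partialFst
    have e : partialFst (fun z => (z.2 : ℂ) ^ m * G z) =
        fun z => (z.2 : ℂ) ^ m * partialFst G z := by
      funext ⟨w, r⟩
      exact (hasDerivAt_partialFst (hG.snd_pow_mul m).1 w r).unique
        ((hasDerivAt_partialFst hG.1 w r).const_mul ((r : ℂ) ^ m))
    have hb : ∀ c : ℝ, c ^ p = 1 → ExpandsUpTo (stepMult p (s + 1)) M
        (monoBdry p q c R fun z => (z.1 : ℂ) ^ (s + 1) * ((z.2 : ℂ) ^ m * G z)) := by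
      intro c hc
      have h2 := monoBdry_isBigO p hq hc hm (hG.fst_pow_mul (s + 1))
      refine ExpandsUpTo.of_isBigO ?_
      convert h2.trans (rpow_neg_isBigO_rpow_neg hMn) using 3
      ring
    refine ExpandsUpTo.of_eulerEq (m := stepMult p (s + 1)) (stepMult_succ_le p s)
      (stepMult_self hp s) (hM s) (eulerEq_monoInt_fst hp q (-1) 1 (hG.snd_pow_mul m) s)
      (ExpandsUpTo.const_smul (ExpandsUpTo.add ?_ (ExpandsUpTo.add
        (ExpandsUpTo.const_smul (hb 1 (one_pow p)) _) (hb (-1) (hp2.neg_one_pow)))) _)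
    rwa [e]

/-- Expansion for the phase `r^q`. -/
theorem expandsUpTo_monoInt_zero {q : ℕ} (hq : 1 ≤ q) (a b R : ℝ) {M : ℝ}
    (hM : ∀ k : ℕ, ((k + 1 : ℝ) / q) ≠ M) (s : ℕ) {G : ℝ × ℝ → ℂ} (hG : SmoothBelow R G) :
    ExpandsUpTo (stepMult q s) M (monoInt 0 q a b R fun z => (z.2 : ℂ) ^ s * G z) := by
  obtain ⟨n, hn⟩ := exists_nat_ge M
  refine expandsUpTo_of_snd_pow 0 hq a b R hM 0 (q * n) s (fun G hG => ?_) G hG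
  refine ExpandsUpTo.of_isBigO ?_
  refine Asymptotics.IsBigO.trans ?_ (rpow_neg_isBigO_rpow_neg hn)
  simpa using monoInt_isBigO 0 hq a b n (K := 0) (m := s + q * n) (by simp) (by omega) hG

/-- Expansion for the phase `w^p r^q` on `-1 ≤ w ≤ 1`, with `p` even. Common exponents of the two
series have multiplicity two, that is, they come with a logarithm. -/
theorem expandsUpTo_monoInt {p q : ℕ} (hp : 1 ≤ p) (hp2 : Even p) (hq : 1 ≤ q) (R : ℝ) {M : ℝ}
    (hM : ∀ k : ℕ, ((k + 1 : ℝ) / q) ≠ M) (hM' : ∀ k : ℕ, ((k + 1 : ℝ) / p) ≠ M) (s : ℕ)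
    {G : ℝ × ℝ → ℂ} (hG : SmoothBelow R G) :
    ExpandsUpTo (stepMult q s + stepMult p 0) M
      (monoInt p q (-1) 1 R fun z => (z.2 : ℂ) ^ s * G z) := by
  obtain ⟨n, hn⟩ := exists_nat_ge M
  refine expandsUpTo_of_snd_pow p hq (-1) 1 R hM _ (q * n) s (fun G hG => ?_) G hG
  have := expandsUpTo_of_fst_pow hp hp2 hq (R := R) hM' hn (m := s + q * n) (by omega) (p * n) 0
    (fun G hG => ?_) G hG
  · simpa using this
  · refine ExpandsUpTo.of_isBigO ?_
    refine Asymptotics.IsBigO.trans ?_ (rpow_neg_isBigO_rpow_neg hn)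
    have := monoInt_isBigO p hq (-1) 1 n (K := p * n) (m := s + q * n) le_rfl (by omega) hG
    simpa [mul_assoc] using this

/-! ### Uniqueness of log-power expansions and a criterion for the oscillation index -/

open Filter Asymptotics

theorem logPow_isLittleO {b b' : ℝ} (h : b' < b) (i : ℕ) :
    logPow b i =o[atTop] fun l : ℝ => l ^ (-b') := by
  have h1 : (fun l : ℝ => Real.log l ^ i) =o[atTop] fun l : ℝ => l ^ (b - b') := by
    have := isLittleO_log_rpow_rpow_atTop (s := b - b') (i : ℝ) (by linarith)
    simpa using this
  have h2 := h1.mul_isBigO (isBigO_refl (fun l : ℝ => l ^ (-b)) atTop)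
  have h3 : (fun l : ℝ => Real.log l ^ i * l ^ (-b)) =o[atTop] fun l : ℝ => l ^ (-b') := by
    refine h2.congr' (Eventually.of_forall fun l => rfl) ?_
    filter_upwards [eventually_gt_atTop 0] with l hl
    rw [← Real.rpow_add hl]
    ring_nf
  refine IsLittleO.of_norm_left (h3.norm_left.congr_left fun l => ?_)
  rw [logPow, Complex.norm_real]

/-- A polynomial in `log l` that tends to zero is zero. -/
theorem eq_zero_of_sum_logPow_isLittleO {n : ℕ} {b : ℝ} {c : ℕ → ℂ}
    (h : (fun l => ∑ i ∈ Finset.range n, c i * logPow b i l) =o[atTop] fun l : ℝ => l ^ (-b)) :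
    ∀ i < n, c i = 0 := by
  set P : Polynomial ℂ := ∑ i ∈ Finset.range n, Polynomial.monomial i (c i)
  have hP : ∀ i < n, P.coeff i = c i := by
    intro i hi
    simp [P, Polynomial.coeff_monomial, hi]
  have ht : Tendsto (fun l : ℝ => ‖P.eval ((Real.log l : ℝ) : ℂ)‖) atTop (𝓝 0) := by
    have h1 := h.norm_norm.tendsto_div_nhds_zero
    refine h1.congr' ?_
    filter_upwards [eventually_gt_atTop 0] with l hl
    have hl0 : l ^ (-b) ≠ 0 := (Real.rpow_pos_of_pos hl _).ne'
    have : ∑ i ∈ Finset.range n, c i * logPow b i l =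
        P.eval ((Real.log l : ℝ) : ℂ) * ((l ^ (-b) : ℝ) : ℂ) := by
      simp only [P, Polynomial.eval_finsetSum, Polynomial.eval_monomial, Finset.sum_mul, logPow]
      push_cast
      simp only [mul_assoc]
    rw [this, norm_mul, Complex.norm_real]
    field_simp
  have hP0 : P = 0 := by
    rcases lt_or_ge 0 P.degree with hd | hd
    · have hz : Tendsto (fun l : ℝ => ‖((Real.log l : ℝ) : ℂ)‖) atTop atTop := by
        simp only [Complex.norm_real]
        exact tendsto_norm_atTop_atTop.comp Real.tendsto_log_atTop
      exact absurd ht (not_tendsto_nhds_of_tendsto_atTop (P.tendsto_norm_atTop hd hz) 0)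
    · rw [Polynomial.eq_C_of_degree_le_zero hd] at ht ⊢
      simp only [Polynomial.eval_C] at ht
      have := tendsto_nhds_unique ht tendsto_const_nhds
      rw [eq_comm, norm_eq_zero] at this
      rw [this, Polynomial.C_0]
  intro i hi
  rw [← hP i hi, hP0, Polynomial.coeff_zero]

/-- The sum of the terms with exponents `s 0, …, s N` of a log-power expansion. -/
noncomputable def logPowSum (n : ℕ) (s : ℕ → ℝ) (N : ℕ) (c : ℕ → ℕ → ℂ) (l : ℝ) : ℂ :=
  ∑ j ∈ Finset.range (N + 1), ∑ i ∈ Finset.range n, c j i * logPow (s j) i l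

theorem isLittleO_rpow_neg_of_le {α : Type*} [Norm α] {F : ℝ → α} {a b : ℝ} (hab : a ≤ b)
    (h : F =o[atTop] fun l : ℝ => l ^ (-b)) : F =o[atTop] fun l : ℝ => l ^ (-a) :=
  h.trans_isBigO (rpow_neg_isBigO_rpow_neg hab)

theorem logPowSum_unique {n : ℕ} {s : ℕ → ℝ} (hs : StrictMono s) {N : ℕ} {c : ℕ → ℕ → ℂ}
    (h : logPowSum n s N c =o[atTop] fun l : ℝ => l ^ (-s N)) :
    ∀ j ≤ N, ∀ i < n, c j i = 0 := by
  intro j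
  induction j using Nat.strong_induction_on with
  | _ j ih =>
    intro hj
    refine eq_zero_of_sum_logPow_isLittleO (b := s j) ?_
    have h1 := isLittleO_rpow_neg_of_le (hs.monotone hj) h
    have h2 : (fun l => ∑ k ∈ (Finset.range (N + 1)).erase j, ∑ i ∈ Finset.range n,
        c k i * logPow (s k) i l) =o[atTop] fun l : ℝ => l ^ (-s j) := by
      refine IsLittleO.fun_sum fun k hk => IsLittleO.fun_sum fun i hi => ?_
      rw [Finset.mem_erase, Finset.mem_range] at hk
      rw [Finset.mem_range] at hi
      rcases lt_or_gt_of_ne hk.1 with hlt | hgt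
      · rw [ih k hlt (by omega) i hi]
        simp
      · exact (logPow_isLittleO (hs hgt) i).const_mul_left _
    refine (h1.sub h2).congr_left fun l => ?_
    rw [logPowSum, ← Finset.add_sum_erase _ _ (Finset.mem_range.2 (Nat.lt_succ_of_le hj))]
    ring

theorem exists_logPowSum_of_mem {n : ℕ} {s : ℕ → ℝ} {m : ℝ → ℕ}
    (hm : ∀ b, 0 < m b → m b ≤ n ∧ ∃ j, b = s j) {g : ℝ → ℂ} (hg : g ∈ logPowSpan m) :
    ∃ (c : ℕ → ℕ → ℂ) (L : ℕ), ∀ N, L ≤ N → ∀ l, g l = logPowSum n s N c l := by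
  induction hg using Submodule.span_induction with
  | mem x hx =>
    obtain ⟨b, i, hi, rfl⟩ := hx
    obtain ⟨hmn, j, rfl⟩ := hm b (by omega)
    refine ⟨fun j' i' => if j' = j ∧ i' = i then 1 else 0, j, fun N hN l => ?_⟩
    unfold logPowSum
    rw [Finset.sum_eq_single_of_mem j (Finset.mem_range.2 (by omega)),
      Finset.sum_eq_single_of_mem i (Finset.mem_range.2 (by omega))]
    · simp
    · intro k _ hk
      simp [hk]
    · intro k _ hk
      simp [hk]
  | zero => exact ⟨fun _ _ => 0, 0, fun N _ l => by simp [logPowSum]⟩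
  | add x y _ _ hx hy =>
    obtain ⟨c, L, hc⟩ := hx
    obtain ⟨c', L', hc'⟩ := hy
    refine ⟨fun j i => c j i + c' j i, max L L', fun N hN l => ?_⟩
    rw [Pi.add_apply, hc N (by omega), hc' N (by omega)]
    simp [logPowSum, add_mul, Finset.sum_add_distrib]
  | smul a x _ hx =>
    obtain ⟨c, L, hc⟩ := hx
    refine ⟨fun j i => a * c j i, L, fun N hN l => ?_⟩
    rw [Pi.smul_apply, hc N hN]
    simp [logPowSum, Finset.mul_sum, mul_assoc]

/-- Expansions with error `O(l^(-M))` for arbitrarily large `M` combine into one asymptotic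
expansion, since the coefficients at different `M` agree. -/
theorem exists_asymptotic_expansion {n : ℕ} {s : ℕ → ℝ} (hs : StrictMono s) {m : ℝ → ℕ}
    (hm : ∀ b, 0 < m b → m b ≤ n ∧ ∃ j, b = s j) {F : ℝ → ℂ}
    (hF : ∀ A : ℝ, ∃ M, A < M ∧ ExpandsUpTo m M F) :
    ∃ c : ℕ → ℕ → ℂ, ∀ N, (fun l => F l - logPowSum n s N c l) =o[atTop]
      fun l : ℝ => l ^ (-s N) := by
  have h1 : ∀ N, ∃ c : ℕ → ℕ → ℂ, ∀ k ≤ N, (fun l => F l - logPowSum n s k c l) =o[atTop]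
      fun l : ℝ => l ^ (-s k) := by
    intro N
    obtain ⟨M, hM, g, hg, hgF⟩ := hF (s N)
    obtain ⟨c, L, hc⟩ := exists_logPowSum_of_mem hm hg
    refine ⟨c, fun k hk => ?_⟩
    have hkM : s k < M := (hs.monotone hk).trans_lt hM
    have h2 : (fun l : ℝ => l ^ (-M)) =o[atTop] fun l : ℝ => l ^ (-s k) := by
      have := logPow_isLittleO hkM 0
      refine (this.norm_left).congr' ?_ (Eventually.of_forall fun _ => rfl)
      filter_upwards [eventually_gt_atTop 0] with l hl
      simp [logPow, abs_of_nonneg (Real.rpow_nonneg hl.le (-M))]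
    have h3 : (fun l => g l - logPowSum n s k c l) =o[atTop] fun l : ℝ => l ^ (-s k) := by
      have h4 : (fun l => ∑ j ∈ Finset.Ico (k + 1) (max k L + 1), ∑ i ∈ Finset.range n,
          c j i * logPow (s j) i l) =o[atTop] fun l : ℝ => l ^ (-s k) := by
        refine IsLittleO.fun_sum fun j hj => IsLittleO.fun_sum fun i hi => ?_
        rw [Finset.mem_Ico] at hj
        exact (logPow_isLittleO (hs (by omega)) i).const_mul_left _
      refine h4.congr_left fun l => ?_
      rw [hc (max k L) (le_max_right _ _), logPowSum, logPowSum,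
        Finset.sum_Ico_eq_sub _ (by omega)]
    exact ((hgF.trans_isLittleO h2).add h3).congr_left fun l => by ring
  choose c hc using h1
  -- The coefficients up to order `k` do not depend on the expansion they are read off from.
  have key : ∀ N k, k ≤ N → ∀ j ≤ k, ∀ i < n, c N j i - c k j i = 0 := by
    intro N k hkN
    refine logPowSum_unique hs (c := fun j i => c N j i - c k j i) ?_
    refine ((hc k k le_rfl).sub (hc N k hkN)).congr_left fun l => ?_
    simp only [logPowSum, sub_mul, Finset.sum_sub_distrib]
    ring
  refine ⟨fun j i => c j j i, fun N => (hc N N le_rfl).congr_left fun l => ?_⟩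
  congr 1
  refine Finset.sum_congr rfl fun j hj => Finset.sum_congr rfl fun i hi => ?_
  rw [Finset.mem_range] at hj hi
  rw [sub_eq_zero.1 (key N j (by omega) j le_rfl i hi)]

/-- If all exponents of the oscillatory integrals are at least `β`, and near the origin there is
always an amplitude whose integral is not `o(l^(-β))`, then `β` is the oscillation index. -/
theorem isOscillationIndex_of_expandsUpTo {n : ℕ} {S : (Fin n → ℝ) → ℝ} {β : ℚ} (hβ : 0 < β)
    {e : ℚ} (he : 0 < e) {U₀ : Set (Fin n → ℝ)} (hU₀ : U₀ ∈ 𝓝 0) {m : ℝ → ℕ}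
    (hm : ∀ b, 0 < m b → m b ≤ n ∧ ∃ j : ℕ, b = β + j * e)
    (hexp : ∀ φ, IsAmplitude U₀ φ →
      ∀ A : ℝ, ∃ M, A < M ∧ ExpandsUpTo m M (oscillatoryIntegral S φ))
    (hlow : ∀ U ∈ 𝓝 (0 : Fin n → ℝ), U ⊆ U₀ → ∃ φ, IsAmplitude U φ ∧
      ¬ oscillatoryIntegral S φ =o[atTop] fun l : ℝ => l ^ (-(β : ℝ))) :
    IsOscillationIndex S β := by
  set s : ℕ → ℚ := fun j => β + j * e with hs
  have hs0 : s 0 = β := by simp [hs]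
  have hsm : StrictMono fun j => (s j : ℝ) := by
    refine strictMono_nat_of_lt_succ fun j => ?_
    have : s j < s (j + 1) := by
      simp only [hs]
      push_cast
      linarith
    exact_mod_cast this
  have hm' : ∀ b, 0 < m b → m b ≤ n ∧ ∃ j, b = (s j : ℝ) := by
    intro b hb
    obtain ⟨h1, j, hj⟩ := hm b hb
    exact ⟨h1, j, by rw [hj]; simp [hs]⟩
  have hex : ∀ φ, ∃ c : ℕ → ℕ → ℂ, IsAmplitude U₀ φ → ∀ N,
      (fun l => oscillatoryIntegral S φ l - logPowSum n (fun j => (s j : ℝ)) N c l) =o[atTop]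
        fun l : ℝ => l ^ (-(s N : ℝ)) := by
    intro φ
    by_cases hφ : IsAmplitude U₀ φ
    · obtain ⟨c, hc⟩ := exists_asymptotic_expansion hsm hm' (hexp φ hφ)
      exact ⟨c, fun _ => hc⟩
    · exact ⟨fun _ _ => 0, fun h => absurd h hφ⟩
  choose c hc using hex
  refine ⟨U₀, hU₀, s, fun i j φ => c φ j i, ⟨β, e, hβ, he, fun j => rfl⟩, ?_, ?_, ?_⟩
  · intro φ hφ N
    exact hc φ hφ N
  · refine ⟨0, by rw [hs0], fun U hU hUU => ?_⟩
    obtain ⟨φ, hφ, hφ'⟩ := hlow U hU hUU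
    refine ⟨φ, hφ, ?_⟩
    by_contra! hcon
    refine hφ' ?_
    have h1 := hc φ ⟨hφ.1, hφ.2.1, hφ.2.2.trans hUU⟩ 0
    rw [hs0] at h1
    refine h1.congr_left fun l => ?_
    rw [logPowSum, Finset.sum_range_one, Finset.sum_eq_zero, sub_zero]
    intro i hi
    rw [hcon i (Finset.mem_range.1 hi), zero_mul]
  · rintro r ⟨j, rfl, -⟩
    have := hsm.monotone (Nat.zero_le j)
    simp only [hs0] at this
    exact this

/-! ### A lower bound for oscillatory integrals with a nonnegative amplitude -/

open MeasureTheory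

/-- The Fejér mean `∫_0^1 (1 - v) e^{ivs} dv`. -/
noncomputable def fejerMean (s : ℝ) : ℂ :=
  ∫ v in (0 : ℝ)..1, ((1 - v : ℝ) : ℂ) * Complex.exp (Complex.I * ((v * s : ℝ) : ℂ))

theorem continuous_fejerMean_integrand (s : ℝ) : Continuous fun v : ℝ =>
    ((1 - v : ℝ) : ℂ) * Complex.exp (Complex.I * ((v * s : ℝ) : ℂ)) := by
  fun_prop

theorem fejerMean_re (s : ℝ) : (fejerMean s).re =
    ∫ v in (0 : ℝ)..1, (1 - v) * Real.cos (v * s) := by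
  have := Complex.reCLM.intervalIntegral_comp_comm
    ((continuous_fejerMean_integrand s).intervalIntegrable 0 1) (μ := volume)
  rw [fejerMean]
  refine this.symm.trans (intervalIntegral.integral_congr fun v _ => ?_)
  simp only [Complex.reCLM_apply, Complex.re_ofReal_mul]
  rw [mul_comm Complex.I, Complex.exp_ofReal_mul_I_re]

theorem fejerMean_re_nonneg (s : ℝ) : 0 ≤ (fejerMean s).re := by
  rw [fejerMean_re]
  rcases eq_or_ne s 0 with rfl | hs
  · refine intervalIntegral.integral_nonneg zero_le_one fun v hv => ?_
    simp only [mul_zero, Real.cos_zero, mul_one]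
    linarith [hv.2]
  · have hd : ∀ v : ℝ, HasDerivAt
        (fun v => (1 - v) * (Real.sin (v * s) / s) - Real.cos (v * s) / s ^ 2)
        ((1 - v) * Real.cos (v * s)) v := by
      intro v
      have h0 : HasDerivAt (fun v : ℝ => v * s) s v := by simpa using (hasDerivAt_id v).mul_const s
      refine ((((hasDerivAt_id v).const_sub 1).mul (h0.sin.div_const s)).sub
        (h0.cos.div_const (s ^ 2))).congr_deriv ?_
      simp only [id]
      field_simp
      ring
    rw [intervalIntegral.integral_eq_sub_of_hasDerivAt (fun v _ => hd v)
      (Continuous.intervalIntegrable (by fun_prop) _ _)]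
    have h1 := Real.cos_le_one s
    have h2 : 0 ≤ (1 - Real.cos s) / s ^ 2 := div_nonneg (by linarith) (sq_nonneg s)
    simp
    rw [sub_div, one_div] at h2
    linarith

theorem quarter_le_fejerMean_re {s : ℝ} (hs : |s| ≤ 1) : 1 / 4 ≤ (fejerMean s).re := by
  rw [fejerMean_re]
  have h1 : ∫ v in (0 : ℝ)..1, (1 - v) * (1 / 2) = 1 / 4 := by
    rw [intervalIntegral.integral_mul_const, intervalIntegral.integral_sub (by simp) (by simp)]
    norm_num
  rw [← h1]
  refine intervalIntegral.integral_mono_on zero_le_one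
    (Continuous.intervalIntegrable (by fun_prop) _ _)
    (Continuous.intervalIntegrable (by fun_prop) _ _) fun v hv => ?_
  refine mul_le_mul_of_nonneg_left ?_ (by linarith [hv.2])
  have h2 := Real.one_sub_sq_div_two_le_cos (x := v * s)
  have h3 : (v * s) ^ 2 ≤ 1 := by
    rw [sq_le_one_iff_abs_le_one, abs_mul, abs_of_nonneg hv.1]
    exact mul_le_one₀ hv.2 (abs_nonneg _) hs
  linarith

section

variable {n : ℕ} {S φ : (Fin n → ℝ) → ℝ}

theorem norm_oscillatory_integrand (l : ℝ) (x : Fin n → ℝ) :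
    ‖Complex.exp (Complex.I * ((l * S x : ℝ) : ℂ)) * ((φ x : ℝ) : ℂ)‖ = ‖φ x‖ := by
  rw [norm_mul, mul_comm Complex.I, Complex.norm_exp_ofReal_mul_I, one_mul, Complex.norm_real]

theorem norm_oscillatoryIntegral_le (l : ℝ) : ‖oscillatoryIntegral S φ l‖ ≤ ∫ x, ‖φ x‖ := by
  refine (norm_integral_le_integral_norm _).trans_eq ?_
  simp only [norm_oscillatory_integrand]

/-- Averaging the oscillatory integral over frequencies with the Fejér weight. -/
theorem integral_fejer_oscillatoryIntegral (hS : Continuous S) (hφ : Continuous φ)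
    (hc : HasCompactSupport φ) (l : ℝ) :
    ∫ v in (0 : ℝ)..1, ((1 - v : ℝ) : ℂ) * oscillatoryIntegral S φ (v * l) =
      ∫ x, fejerMean (l * S x) * ((φ x : ℝ) : ℂ) := by
  have hi : Integrable φ := hφ.integrable_of_hasCompactSupport hc
  set f : ℝ → (Fin n → ℝ) → ℂ := fun v x =>
    ((1 - v : ℝ) : ℂ) * (Complex.exp (Complex.I * ((v * l * S x : ℝ) : ℂ)) * ((φ x : ℝ) : ℂ))
  have hint : Integrable (Function.uncurry f)
      ((volume.restrict (Set.uIoc (0 : ℝ) 1)).prod volume) := by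
    have h1 : Integrable (fun z : ℝ × (Fin n → ℝ) => (1 : ℝ) * ‖φ z.2‖)
        ((volume.restrict (Set.uIoc (0 : ℝ) 1)).prod volume) := by
      exact Integrable.mul_prod (f := fun _ : ℝ => (1 : ℝ)) (g := fun x => ‖φ x‖)
        (intervalIntegrable_const (c := (1 : ℝ)) (a := 0) (b := 1)).def' hi.norm
    refine h1.mono' ?_ ?_
    · refine Continuous.aestronglyMeasurable ?_
      simp only [f, Function.uncurry_def]
      fun_prop
    · have h2 : ∀ᵐ z : ℝ × (Fin n → ℝ) ∂((volume.restrict (Set.uIoc (0 : ℝ) 1)).prod volume),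
          z.1 ∈ Set.uIoc (0 : ℝ) 1 :=
        Measure.quasiMeasurePreserving_fst.ae (ae_restrict_mem measurableSet_uIoc)
      filter_upwards [h2] with z hz
      rw [Set.uIoc_of_le zero_le_one] at hz
      simp only [f, Function.uncurry_def]
      rw [norm_mul, norm_oscillatory_integrand, Complex.norm_real]
      refine mul_le_mul_of_nonneg_right ?_ (norm_nonneg _)
      rw [Real.norm_of_nonneg (by linarith [hz.2])]
      linarith [hz.1]
  have h3 := MeasureTheory.intervalIntegral_integral_swap hint
  simp only [f] at h3
  calc _ = _ := by
        refine intervalIntegral.integral_congr fun v _ => ?_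
        rw [oscillatoryIntegral, ← integral_const_mul]
    _ = _ := h3
    _ = _ := by
        refine integral_congr_ae (Eventually.of_forall fun x => ?_)
        simp only
        rw [fejerMean, ← intervalIntegral.integral_mul_const]
        refine intervalIntegral.integral_congr fun v _ => ?_
        simp only [mul_assoc]

theorem fejer_isLittleO {F : ℝ → ℂ} {C : ℝ} (hC : ∀ l, ‖F l‖ ≤ C) {β : ℝ}
    (hβ1 : β < 1) (hF : F =o[atTop] fun l : ℝ => l ^ (-β)) :
    (fun l => ∫ v in (0 : ℝ)..1, ((1 - v : ℝ) : ℂ) * F (v * l)) =o[atTop]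
      fun l : ℝ => l ^ (-β) := by
  rw [isLittleO_iff]
  intro ε hε
  have hC0 : 0 ≤ C := (norm_nonneg _).trans (hC 0)
  set ε' : ℝ := ε / 2 * (1 - β) with hε'
  have hε'0 : 0 < ε' := mul_pos (by linarith) (by linarith)
  obtain ⟨L₀, hL₀⟩ := eventually_atTop.1 (isLittleO_iff.1 hF hε'0)
  set L := max L₀ 1
  have hL : 0 < L := lt_of_lt_of_le one_pos (le_max_right _ _)
  set γ : ℝ := (1 + max β 0) / 2 with hγ
  have hγ1 : γ < 1 := by
    have : max β 0 < 1 := max_lt hβ1 one_pos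
    linarith
  have hγ0 : 0 < γ := by
    have := le_max_right β 0
    linarith
  have hβγ : β < γ := by
    have h1 : max β 0 < 1 := max_lt hβ1 one_pos
    have h2 := le_max_left β 0
    linarith
  -- For small `l` the bound `C` is absorbed by the factor `(L / l) ^ γ ≥ 1`.
  have hb : ∀ l, 0 < l → ‖F l‖ ≤ ε' * l ^ (-β) + C * L ^ γ * l ^ (-γ) := by
    intro l hl
    have h1 : 0 ≤ ε' * l ^ (-β) := mul_nonneg hε'0.le (Real.rpow_nonneg hl.le _)
    have h2 : 0 ≤ C * L ^ γ * l ^ (-γ) := by positivity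
    rcases le_total L l with h | h
    · have := hL₀ l ((le_max_left _ _).trans h)
      rw [Real.norm_of_nonneg (Real.rpow_nonneg hl.le _)] at this
      linarith
    · have h3 : 1 ≤ L ^ γ * l ^ (-γ) := by
        rw [Real.rpow_neg hl.le, ← div_eq_mul_inv, one_le_div (Real.rpow_pos_of_pos hl _)]
        exact Real.rpow_le_rpow hl.le h hγ0.le
      have := mul_le_mul_of_nonneg_left h3 hC0
      have := hC l
      nlinarith
  have hev : ∀ᶠ l : ℝ in atTop, C * L ^ γ / (1 - γ) * l ^ (-γ) ≤ ε / 2 * l ^ (-β) := by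
    have h1 := (logPow_isLittleO hβγ 0).const_mul_left ((C * L ^ γ / (1 - γ) : ℝ) : ℂ)
    filter_upwards [isLittleO_iff.1 h1 (half_pos hε), eventually_gt_atTop 0] with l hl hl0
    rw [Real.norm_of_nonneg (Real.rpow_nonneg hl0.le _)] at hl
    refine le_trans ?_ hl
    rw [norm_mul, logPow, Complex.norm_real, Complex.norm_real, ← norm_mul, pow_zero, one_mul]
    exact Real.le_norm_self _
  filter_upwards [hev, eventually_gt_atTop 0] with l hl hl0
  rw [Real.norm_of_nonneg (Real.rpow_nonneg hl0.le _)]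
  have hint1 : IntervalIntegrable (fun v : ℝ => ε' * l ^ (-β) * v ^ (-β)) volume 0 1 :=
    (intervalIntegral.intervalIntegrable_rpow' (by linarith)).const_mul _
  have hint2 : IntervalIntegrable (fun v : ℝ => C * L ^ γ * l ^ (-γ) * v ^ (-γ)) volume 0 1 :=
    (intervalIntegral.intervalIntegrable_rpow' (by linarith)).const_mul _
  refine (intervalIntegral.norm_integral_le_of_norm_le zero_le_one
    (Eventually.of_forall fun v hv => ?_) (hint1.add hint2)).trans ?_
  · rw [norm_mul, Complex.norm_real, Real.norm_of_nonneg (by linarith [hv.2])]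
    have h1 := hb (v * l) (mul_pos hv.1 hl0)
    rw [Real.mul_rpow hv.1.le hl0.le, Real.mul_rpow hv.1.le hl0.le] at h1
    calc (1 - v) * ‖F (v * l)‖ ≤ 1 * ‖F (v * l)‖ :=
          mul_le_mul_of_nonneg_right (by linarith [hv.1]) (norm_nonneg _)
      _ ≤ _ := by rw [one_mul]; refine h1.trans_eq ?_; ring
  · have h0 : ∀ a : ℝ, a < 1 → ∫ v in (0 : ℝ)..1, v ^ (-a) = 1 / (1 - a) := by
      intro a ha
      rw [integral_rpow (Or.inl (by linarith)), Real.one_rpow, Real.zero_rpow (by linarith)]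
      ring_nf
    rw [intervalIntegral.integral_add hint1 hint2, intervalIntegral.integral_const_mul,
      intervalIntegral.integral_const_mul, h0 β hβ1, h0 γ hγ1]
    have h1 : ε' * l ^ (-β) * (1 / (1 - β)) = ε / 2 * l ^ (-β) := by
      have : 1 - β ≠ 0 := by linarith
      rw [hε']
      field_simp
    have h2 : C * L ^ γ * l ^ (-γ) * (1 / (1 - γ)) = C * L ^ γ / (1 - γ) * l ^ (-γ) := by ring
    rw [h1, h2]
    linarith

/-- If the sublevel sets `{|S| ≤ 1 / l}` have measure at least `c l^(-β)` inside `{φ ≥ 1}`, where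
`φ ≥ 0`, then the oscillatory integral is not `o(l^(-β))`. -/
theorem not_isLittleO_oscillatoryIntegral (hS : Continuous S) (hφ : Continuous φ)
    (hc : HasCompactSupport φ) (hφ0 : ∀ x, 0 ≤ φ x) {β c : ℝ} (hβ1 : β < 1) (hc0 : 0 < c)
    (hE : ∀ᶠ l : ℝ in atTop, ∃ E : Set (Fin n → ℝ), MeasurableSet E ∧
      (∀ x ∈ E, |l * S x| ≤ 1 ∧ 1 ≤ φ x) ∧ ENNReal.ofReal (c * l ^ (-β)) ≤ volume E) :
    ¬ oscillatoryIntegral S φ =o[atTop] fun l : ℝ => l ^ (-β) := by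
  intro ho
  have hi : Integrable φ := hφ.integrable_of_hasCompactSupport hc
  have h1 := fejer_isLittleO (norm_oscillatoryIntegral_le (S := S) (φ := φ)) hβ1 ho
  have h2 := isLittleO_iff.1 h1 (show (0 : ℝ) < c / 8 by linarith)
  obtain ⟨l, hl, ⟨E, hEm, hEφ, hEv⟩, hl0⟩ := (h2.and (hE.and (eventually_gt_atTop 0))).exists
  rw [integral_fejer_oscillatoryIntegral hS hφ hc, Real.norm_of_nonneg (Real.rpow_nonneg hl0.le _)]
    at hl
  have hk : Continuous fejerMean := by
    unfold fejerMean
    exact intervalIntegral.continuous_parametric_intervalIntegral_of_continuous' (by fun_prop) 0 1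
  have hcont : Continuous fun x => fejerMean (l * S x) * ((φ x : ℝ) : ℂ) := by fun_prop
  have hint : Integrable fun x => fejerMean (l * S x) * ((φ x : ℝ) : ℂ) := by
    refine hcont.integrable_of_hasCompactSupport ?_
    refine HasCompactSupport.mul_left ?_
    exact hc.comp_left (g := fun r : ℝ => (r : ℂ)) Complex.ofReal_zero
  have hre : ∀ x, (fejerMean (l * S x) * ((φ x : ℝ) : ℂ)).re = (fejerMean (l * S x)).re * φ x :=
    fun x => by simp
  have h3 : (∫ x, fejerMean (l * S x) * ((φ x : ℝ) : ℂ)).re =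
      ∫ x, (fejerMean (l * S x)).re * φ x := by
    have := integral_re hint
    simp only [RCLike.re_eq_complex_re, hre] at this
    exact this.symm
  have hint' : Integrable fun x => (fejerMean (l * S x)).re * φ x := by
    have := hint.re
    simpa only [RCLike.re_eq_complex_re, hre] using this
  have hEfin : volume E ≠ ⊤ := by
    have h4 : E ⊆ tsupport φ := fun x hx => subset_tsupport _ (by
      have := (hEφ x hx).2
      simp only [Function.mem_support]
      linarith)
    exact ((measure_mono h4).trans_lt hc.isCompact.measure_lt_top).ne
  have h4 : (1 / 4 : ℝ) * volume.real E ≤ ∫ x, (fejerMean (l * S x)).re * φ x := by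
    calc (1 / 4 : ℝ) * volume.real E = ∫ x in E, (1 / 4 : ℝ) := by
          rw [setIntegral_const, smul_eq_mul, mul_comm]
      _ ≤ ∫ x in E, (fejerMean (l * S x)).re * φ x := by
          refine setIntegral_mono_on (integrableOn_const hEfin) hint'.integrableOn hEm
            fun x hx => ?_
          have h5 := quarter_le_fejerMean_re (hEφ x hx).1
          have h6 := (hEφ x hx).2
          nlinarith
      _ ≤ _ := setIntegral_le_integral hint' (Eventually.of_forall fun x =>
          mul_nonneg (fejerMean_re_nonneg _) (hφ0 x))
  have h5 : c * l ^ (-β) ≤ volume.real E := by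
    rw [Measure.real, ← ENNReal.ofReal_le_iff_le_toReal hEfin]
    exact hEv
  have h6 := (Complex.re_le_norm _).trans hl
  rw [h3] at h6
  have h7 : 0 < c * l ^ (-β) := mul_pos hc0 (Real.rpow_pos_of_pos hl0 _)
  nlinarith

end

/-- Every neighborhood of the origin carries a nonnegative amplitude equal to `1` near it. -/
theorem exists_isAmplitude {n : ℕ} {U : Set (Fin n → ℝ)} (hU : U ∈ 𝓝 0) :
    ∃ δ > 0, ∃ φ, IsAmplitude U φ ∧ (∀ x, 0 ≤ φ x) ∧ ∀ x, (∀ i, |x i| ≤ δ) → φ x = 1 := by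
  obtain ⟨ε, hε, hεU⟩ := Metric.nhds_basis_closedBall.mem_iff.1 hU
  let f : ContDiffBump (0 : Fin n → ℝ) := ⟨ε / 2, ε, half_pos hε, half_lt_self hε⟩
  refine ⟨ε / 2, half_pos hε, f, ⟨f.contDiff, f.hasCompactSupport, ?_⟩, fun x => f.nonneg, ?_⟩
  · rw [f.tsupport_eq]
    exact hεU
  · intro x hx
    refine f.one_of_mem_closedBall ?_
    rw [mem_closedBall_zero_iff, pi_norm_le_iff_of_nonneg (half_pos hε).le]
    exact hx

/-! ### Sublevel sets of the phases `V_t` -/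

theorem continuous_phaseV (t : ℝ) : Continuous (phaseV t) := by
  unfold phaseV
  fun_prop

/-- Lower bounds for the measure of the sublevel sets of `V_t` near the origin show that the
oscillatory integrals do not decay too fast. -/
theorem exists_isAmplitude_not_isLittleO {t β : ℝ} (hβ1 : β < 1)
    (h : ∀ δ > 0, ∃ c > 0, ∀ᶠ l : ℝ in atTop, ∃ E : Set (Fin 3 → ℝ), MeasurableSet E ∧
      (∀ x ∈ E, (∀ i, |x i| ≤ δ) ∧ |l * phaseV t x| ≤ 1) ∧
        ENNReal.ofReal (c * l ^ (-β)) ≤ volume E)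
    {U : Set (Fin 3 → ℝ)} (hU : U ∈ 𝓝 0) :
    ∃ φ, IsAmplitude U φ ∧
      ¬ oscillatoryIntegral (phaseV t) φ =o[atTop] fun l : ℝ => l ^ (-β) := by
  obtain ⟨δ, hδ, φ, hφ, hφ0, hφ1⟩ := exists_isAmplitude hU
  obtain ⟨c, hc, hE⟩ := h δ hδ
  refine ⟨φ, hφ, not_isLittleO_oscillatoryIntegral (continuous_phaseV t) hφ.1.continuous hφ.2.1 hφ0
    hβ1 hc ?_⟩
  filter_upwards [hE] with l ⟨E, hEm, hEx, hEv⟩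
  exact ⟨E, hEm, fun x hx => ⟨(hEx x hx).2, (hφ1 x (hEx x hx).1).ge⟩, hEv⟩

theorem volume_symm_box (a b : ℝ) : volume (Set.Icc (![-a, -b, -b] : Fin 3 → ℝ) ![a, b, b]) =
    ENNReal.ofReal (2 * a) * ENNReal.ofReal (2 * b) * ENNReal.ofReal (2 * b) := by
  rw [Real.volume_Icc_pi, Fin.prod_univ_three]
  simp [two_mul]

theorem abs_le_of_mem_symm_box {a b : ℝ} {x : Fin 3 → ℝ}
    (hx : x ∈ Set.Icc (![-a, -b, -b] : Fin 3 → ℝ) ![a, b, b]) :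
    |x 0| ≤ a ∧ |x 1| ≤ b ∧ |x 2| ≤ b := by
  obtain ⟨h1, h2⟩ := hx
  refine ⟨abs_le.2 ⟨h1 0, h2 0⟩, abs_le.2 ⟨h1 1, h2 1⟩, abs_le.2 ⟨h1 2, h2 2⟩⟩

/-- If `V_t ≤ 1 / l` on the box with half-sides `a l^(-u)`, `a l^(-1/4)`, `a l^(-1/4)`, then the
sublevel sets have measure at least of the order of `l^(-(u + 1/2))`. -/
theorem sublevel_of_box {t u a : ℝ} (hu : 0 < u) (ha : 0 < a)
    (hbox : ∀ l : ℝ, 1 ≤ l → ∀ x : Fin 3 → ℝ, |x 0| ≤ a * l ^ (-u) →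
      |x 1| ≤ a * l ^ (-(1 / 4 : ℝ)) → |x 2| ≤ a * l ^ (-(1 / 4 : ℝ)) → |l * phaseV t x| ≤ 1) :
    ∀ δ > 0, ∃ c > 0, ∀ᶠ l : ℝ in atTop, ∃ E : Set (Fin 3 → ℝ), MeasurableSet E ∧
      (∀ x ∈ E, (∀ i, |x i| ≤ δ) ∧ |l * phaseV t x| ≤ 1) ∧
        ENNReal.ofReal (c * l ^ (-(u + 1 / 2))) ≤ volume E := by
  intro δ hδ
  refine ⟨8 * a ^ 3, by positivity, ?_⟩
  have h1 : Tendsto (fun l : ℝ => a * l ^ (-u)) atTop (𝓝 0) := by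
    simpa using (tendsto_rpow_neg_atTop hu).const_mul a
  have h2 : Tendsto (fun l : ℝ => a * l ^ (-(1 / 4 : ℝ))) atTop (𝓝 0) := by
    simpa using (tendsto_rpow_neg_atTop (y := 1 / 4) (by norm_num)).const_mul a
  filter_upwards [h1.eventually_le_const hδ, h2.eventually_le_const hδ, eventually_ge_atTop 1]
    with l hl1 hl2 hl
  have hl0 : 0 < l := by linarith
  refine ⟨_, measurableSet_Icc (a := ![-(a * l ^ (-u)), -(a * l ^ (-(1 / 4 : ℝ))),
    -(a * l ^ (-(1 / 4 : ℝ)))]) (b := ![a * l ^ (-u), a * l ^ (-(1 / 4 : ℝ)),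
      a * l ^ (-(1 / 4 : ℝ))]), fun x hx => ?_, ?_⟩
  · obtain ⟨h3, h4, h5⟩ := abs_le_of_mem_symm_box hx
    refine ⟨fun i => ?_, hbox l hl x h3 h4 h5⟩
    fin_cases i
    · exact h3.trans hl1
    · exact h4.trans hl2
    · exact h5.trans hl2
  · rw [volume_symm_box, ← ENNReal.ofReal_mul (by positivity), ← ENNReal.ofReal_mul (by positivity)]
    refine ENNReal.ofReal_le_ofReal (le_of_eq ?_)
    have h3 : l ^ (-(u + 1 / 2)) = l ^ (-u) * l ^ (-(1 / 4 : ℝ)) * l ^ (-(1 / 4 : ℝ)) := by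
      rw [← Real.rpow_add hl0, ← Real.rpow_add hl0]
      ring_nf
    rw [h3]
    ring

theorem rpow_neg_quarter_pow {l : ℝ} (hl : 0 < l) : l * (l ^ (-(1 / 4 : ℝ))) ^ 4 = 1 := by
  rw [← Real.rpow_natCast, ← Real.rpow_mul hl.le]
  norm_num
  rw [Real.rpow_neg_one, mul_inv_cancel₀ hl.ne']

theorem abs_mul_sq_le_one {l Q k a h : ℝ} (hl : 0 ≤ l) (hlh : l * h ^ 4 = 1) (hQ0 : 0 ≤ Q)
    (hQ : Q ≤ k * (a * h) ^ 2) (hka : k * a ^ 2 ≤ 1) : |l * Q ^ 2| ≤ 1 := by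
  rw [abs_of_nonneg (mul_nonneg hl (sq_nonneg _))]
  have h1 : Q ≤ h ^ 2 := by nlinarith [sq_nonneg h]
  calc l * Q ^ 2 ≤ l * (h ^ 2) ^ 2 :=
        mul_le_mul_of_nonneg_left (pow_le_pow_left₀ hQ0 h1 2) hl
    _ = 1 := by rw [← hlh]; ring

theorem sublevel_of_pos {t : ℝ} (ht : 0 < t) :
    ∀ δ > 0, ∃ c > 0, ∀ᶠ l : ℝ in atTop, ∃ E : Set (Fin 3 → ℝ), MeasurableSet E ∧
      (∀ x ∈ E, (∀ i, |x i| ≤ δ) ∧ |l * phaseV t x| ≤ 1) ∧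
        ENNReal.ofReal (c * l ^ (-(3 / 4 : ℝ))) ≤ volume E := by
  have ha1 : 1 / (3 + t) ≤ 1 := by rw [div_le_one (by linarith)]; linarith
  have ha0 : 0 < 1 / (3 + t) := by positivity
  have := sublevel_of_box (t := t) (u := 1 / 4) (a := 1 / (3 + t)) (by norm_num) ha0
    (fun l hl x h1 h2 h3 => ?_)
  · convert this using 9
    norm_num
  · have hl0 : 0 < l := by linarith
    set h : ℝ := l ^ (-(1 / 4 : ℝ)) with hh
    have hh0 : 0 < h := Real.rpow_pos_of_pos hl0 _
    have hh1 : h ≤ 1 := Real.rpow_le_one_of_one_le_of_nonpos hl (by norm_num)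
    set a := 1 / (3 + t)
    have hah : a * h ≤ 1 := mul_le_one₀ ha1 hh0.le hh1
    have e0 := sq_le_sq' (abs_le.1 h1).1 (abs_le.1 h1).2
    have e1 := sq_le_sq' (abs_le.1 h2).1 (abs_le.1 h2).2
    have e2 := sq_le_sq' (abs_le.1 h3).1 (abs_le.1 h3).2
    refine abs_mul_sq_le_one (k := 3 + t) (a := a) (h := h) hl0.le (rpow_neg_quarter_pow hl0)
      (by positivity) ?_ ?_
    · have hah2 : (a * h) ^ 2 ≤ 1 := pow_le_one₀ (by positivity) hah
      have e3 : x 0 ^ 4 ≤ (a * h) ^ 2 := by nlinarith [sq_nonneg (x 0)]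
      nlinarith
    · have : (3 + t) * a = 1 := by simp only [a]; field_simp
      nlinarith

theorem sublevel_zero :
    ∀ δ > 0, ∃ c > 0, ∀ᶠ l : ℝ in atTop, ∃ E : Set (Fin 3 → ℝ), MeasurableSet E ∧
      (∀ x ∈ E, (∀ i, |x i| ≤ δ) ∧ |l * phaseV 0 x| ≤ 1) ∧
        ENNReal.ofReal (c * l ^ (-(5 / 8 : ℝ))) ≤ volume E := by
  have := sublevel_of_box (t := 0) (u := 1 / 8) (a := 1 / 3) (by norm_num) (by norm_num)
    (fun l hl x h1 h2 h3 => ?_)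
  · convert this using 9
    norm_num
  · have hl0 : 0 < l := by linarith
    set h : ℝ := l ^ (-(1 / 4 : ℝ)) with hh
    set g : ℝ := l ^ (-(1 / 8 : ℝ)) with hg
    have hgh : g ^ 2 = h := by
      rw [hg, ← Real.rpow_natCast, ← Real.rpow_mul hl0.le, hh]
      norm_num
    have e0 := sq_le_sq' (abs_le.1 h1).1 (abs_le.1 h1).2
    have e1 := sq_le_sq' (abs_le.1 h2).1 (abs_le.1 h2).2
    have e2 := sq_le_sq' (abs_le.1 h3).1 (abs_le.1 h3).2
    rw [mul_pow, hgh] at e0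
    refine abs_mul_sq_le_one (k := 3) (a := 1 / 3) (h := h) hl0.le (rpow_neg_quarter_pow hl0)
      (by positivity) ?_ (by norm_num)
    have e3 : x 0 ^ 4 ≤ ((1 / 3) ^ 2 * h) ^ 2 := by
      have := pow_le_pow_left₀ (sq_nonneg _) e0 2
      nlinarith
    nlinarith [sq_nonneg h]

/-- The measure of the region above a base `B` and between the graphs of `g` and `g + e`. -/
theorem volume_graph_slab {B : Set (Fin 2 → ℝ)} (hB : IsClosed B) {g : (Fin 2 → ℝ) → ℝ}
    (hg : Continuous g) (e : ℝ) :
    IsClosed {x : Fin 3 → ℝ | ![x 0, x 1] ∈ B ∧ g ![x 0, x 1] ≤ x 2 ∧ x 2 ≤ g ![x 0, x 1] + e} ∧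
    volume B * ENNReal.ofReal e ≤ volume
      {x : Fin 3 → ℝ | ![x 0, x 1] ∈ B ∧ g ![x 0, x 1] ≤ x 2 ∧ x 2 ≤ g ![x 0, x 1] + e} := by
  have hproj : Continuous fun x : Fin 3 → ℝ => (![x 0, x 1] : Fin 2 → ℝ) := by
    refine continuous_pi fun i => ?_
    fin_cases i
    · exact continuous_apply 0
    · exact continuous_apply 1
  have hcl : IsClosed {x : Fin 3 → ℝ | ![x 0, x 1] ∈ B ∧ g ![x 0, x 1] ≤ x 2 ∧
      x 2 ≤ g ![x 0, x 1] + e} :=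
    (hB.preimage hproj).inter ((isClosed_le (hg.comp hproj) (continuous_apply 2)).inter
      (isClosed_le (continuous_apply 2) ((hg.comp hproj).add continuous_const)))
  refine ⟨hcl, ?_⟩
  set T : Set (ℝ × (Fin 2 → ℝ)) := {z | z.2 ∈ B ∧ g z.2 ≤ z.1 ∧ z.1 ≤ g z.2 + e} with hT
  have hTm : MeasurableSet T := by
    refine IsClosed.measurableSet ?_
    exact (hB.preimage continuous_snd).inter
      ((isClosed_le (hg.comp continuous_snd) continuous_fst).inter
        (isClosed_le continuous_fst ((hg.comp continuous_snd).add continuous_const)))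
  have hmp := volume_preserving_piFinSuccAbove (fun _ : Fin 3 => ℝ) 2
  have hpre : {x : Fin 3 → ℝ | ![x 0, x 1] ∈ B ∧ g ![x 0, x 1] ≤ x 2 ∧
      x 2 ≤ g ![x 0, x 1] + e} = MeasurableEquiv.piFinSuccAbove (fun _ : Fin 3 => ℝ) 2 ⁻¹' T := by
    ext x
    have h1 : (MeasurableEquiv.piFinSuccAbove (fun _ : Fin 3 => ℝ) 2 x).1 = x 2 := rfl
    have h2 : (MeasurableEquiv.piFinSuccAbove (fun _ : Fin 3 => ℝ) 2 x).2 = ![x 0, x 1] := by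
      funext i
      fin_cases i <;> rfl
    simp only [Set.mem_preimage, hT, Set.mem_ofPred_eq, h1, h2]
  rw [hpre, hmp.measure_preimage hTm.nullMeasurableSet, Measure.volume_eq_prod,
    Measure.prod_apply_symm hTm]
  have h3 : ∀ y ∈ B, volume ((fun z : ℝ => (z, y)) ⁻¹' T) = ENNReal.ofReal e := by
    intro y hy
    have : (fun z : ℝ => (z, y)) ⁻¹' T = Set.Icc (g y) (g y + e) := by
      ext z
      simp [hT, hy]
    rw [this, Real.volume_Icc, add_sub_cancel_left]
  calc volume B * ENNReal.ofReal e = ∫⁻ y in B, ENNReal.ofReal e := by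
        rw [setLIntegral_const, mul_comm]
    _ = ∫⁻ y in B, volume ((fun z : ℝ => (z, y)) ⁻¹' T) :=
        setLIntegral_congr_fun hB.measurableSet fun y hy => (h3 y hy).symm
    _ ≤ _ := setLIntegral_le_lintegral _ _

/-- On `a ≤ x ≤ 2a`, `|y| ≤ a k / 2` the zero set of `V_{-k²}` is the graph of a function
`z = G(x, y)` with `0 ≤ G ≤ 2 a k`. -/
theorem sqrt_graph_bounds {k a x y : ℝ} (ha : 0 < a) (hk : 0 < k) (hak : 4 * a ≤ k)
    (hx1 : a ≤ x) (hx2 : x ≤ 2 * a) (hy : y ^ 2 ≤ (a * k / 2) ^ 2) :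
    √(k ^ 2 * x ^ 2 - x ^ 4 - y ^ 2) ^ 2 = k ^ 2 * x ^ 2 - x ^ 4 - y ^ 2 ∧
      √(k ^ 2 * x ^ 2 - x ^ 4 - y ^ 2) ≤ 2 * a * k := by
  have hx3 : a ^ 2 ≤ x ^ 2 := pow_le_pow_left₀ ha.le hx1 2
  have hx4 : x ^ 2 ≤ (2 * a) ^ 2 := pow_le_pow_left₀ (ha.le.trans hx1) hx2 2
  have hx5 : (4 * a) ^ 2 ≤ k ^ 2 := pow_le_pow_left₀ (by positivity) hak 2
  have h1 : x ^ 2 * x ^ 2 ≤ x ^ 2 * (k ^ 2 / 4) :=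
    mul_le_mul_of_nonneg_left (by linarith) (sq_nonneg x)
  have h2 : k ^ 2 * a ^ 2 ≤ k ^ 2 * x ^ 2 := mul_le_mul_of_nonneg_left hx3 (sq_nonneg k)
  have h3 : k ^ 2 * x ^ 2 ≤ k ^ 2 * (2 * a) ^ 2 := mul_le_mul_of_nonneg_left hx4 (sq_nonneg k)
  have h4 : 0 ≤ k ^ 2 * a ^ 2 := by positivity
  refine ⟨Real.sq_sqrt ?_, Real.sqrt_le_iff.2 ⟨by positivity, ?_⟩⟩
  · nlinarith
  · nlinarith [sq_nonneg (x ^ 2), sq_nonneg y]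

/-- For `t < 0` the zero set of `V_t` is a surface through every neighborhood of the origin, and
`V_t ≤ 1 / l` on a layer around it of thickness of the order of `l^(-1/2)`. -/
theorem sublevel_of_neg {t : ℝ} (ht : t < 0) :
    ∀ δ > 0, ∃ c > 0, ∀ᶠ l : ℝ in atTop, ∃ E : Set (Fin 3 → ℝ), MeasurableSet E ∧
      (∀ x ∈ E, (∀ i, |x i| ≤ δ) ∧ |l * phaseV t x| ≤ 1) ∧
        ENNReal.ofReal (c * l ^ (-(1 / 2 : ℝ))) ≤ volume E := by
  intro δ hδ
  obtain ⟨k, hk, rfl⟩ : ∃ k : ℝ, 0 < k ∧ t = -k ^ 2 :=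
    ⟨√(-t), Real.sqrt_pos.2 (by linarith), by rw [Real.sq_sqrt (by linarith)]; ring⟩
  -- On `a ≤ x ≤ 2a`, `|y| ≤ d` the surface is the graph of a function `z = g(x, y)` with
  -- `0 ≤ g ≤ δ / 2`.
  obtain ⟨a, ha0, ha1, ha2, ha3⟩ : ∃ a : ℝ, 0 < a ∧ 2 * a ≤ δ ∧ 4 * a ≤ k ∧ 4 * (a * k) ≤ δ := by
    refine ⟨min (δ / 2) (min (k / 4) (δ / (4 * k))), by positivity, ?_, ?_, ?_⟩
    · have := min_le_left (δ / 2) (min (k / 4) (δ / (4 * k)))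
      linarith
    · have := (min_le_right (δ / 2) (min (k / 4) (δ / (4 * k)))).trans (min_le_left _ _)
      linarith
    · have := (min_le_right (δ / 2) (min (k / 4) (δ / (4 * k)))).trans (min_le_right _ _)
      rw [le_div_iff₀ (by positivity)] at this
      linarith
  set d : ℝ := min δ (a * k / 2) with hd
  have hd0 : 0 < d := by positivity
  have hd1 : d ≤ δ := min_le_left _ _
  have hd2 : d ≤ a * k / 2 := min_le_right _ _
  set η : ℝ := min (δ / 2) (1 / (2 * δ)) with hη
  have hη0 : 0 < η := by positivity
  have hη1 : η ≤ δ / 2 := min_le_left _ _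
  have hη2 : η * (2 * δ) ≤ 1 := by
    rw [← le_div_iff₀ (by positivity)]
    exact min_le_right _ _
  set g : (Fin 2 → ℝ) → ℝ := fun y => √(k ^ 2 * y 0 ^ 2 - y 0 ^ 4 - y 1 ^ 2) with hg
  have hgc : Continuous g := by
    simp only [hg]
    fun_prop
  set B : Set (Fin 2 → ℝ) := Set.Icc ![a, -d] ![2 * a, d] with hB
  refine ⟨a * (2 * d) * η, by positivity, ?_⟩
  filter_upwards [eventually_ge_atTop 1] with l hl
  have hl0 : 0 < l := by linarith
  set τ : ℝ := l ^ (-(1 / 2 : ℝ)) with hτ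
  have hτ0 : 0 < τ := Real.rpow_pos_of_pos hl0 _
  have hτ1 : τ ≤ 1 := Real.rpow_le_one_of_one_le_of_nonpos hl (by norm_num)
  have hlτ : l * τ ^ 2 = 1 := by
    rw [hτ, ← Real.rpow_natCast, ← Real.rpow_mul hl0.le]
    norm_num
    rw [Real.rpow_neg_one, mul_inv_cancel₀ hl0.ne']
  obtain ⟨hcl, hvol⟩ := volume_graph_slab (B := B) isClosed_Icc hgc (η * τ)
  refine ⟨_, hcl.measurableSet, ?_, le_trans (le_of_eq ?_) hvol⟩
  · rintro x ⟨hxB, hx1, hx2⟩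
    obtain ⟨hb1, hb2⟩ := hxB
    have b1 : a ≤ x 0 := hb1 0
    have b2 : x 0 ≤ 2 * a := hb2 0
    have b3 : -d ≤ x 1 := hb1 1
    have b4 : x 1 ≤ d := hb2 1
    have hgx : g ![x 0, x 1] = √(k ^ 2 * x 0 ^ 2 - x 0 ^ 4 - x 1 ^ 2) := by simp [hg]
    rw [hgx] at hx1 hx2
    set G := √(k ^ 2 * x 0 ^ 2 - x 0 ^ 4 - x 1 ^ 2) with hG
    have hG0 : 0 ≤ G := Real.sqrt_nonneg _
    obtain ⟨hG2, hGle⟩ := sqrt_graph_bounds ha0 hk ha2 b1 b2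
      (sq_le_sq' (by linarith) (b4.trans hd2))
    rw [← hG] at hG2 hGle
    have hητ : η * τ ≤ η := mul_le_of_le_one_right hη0.le hτ1
    have hx2δ : x 2 ≤ δ := by linarith
    refine ⟨fun i => ?_, ?_⟩
    · fin_cases i
      · exact abs_le.2 ⟨by simp only [Fin.zero_eta]; linarith,
          by simp only [Fin.zero_eta]; linarith⟩
      · exact abs_le.2 ⟨by simp only [Fin.mk_one]; linarith, by simp only [Fin.mk_one]; linarith⟩
      · exact abs_le.2 ⟨by simp only [Fin.reduceFinMk]; linarith,
          by simp only [Fin.reduceFinMk]; linarith⟩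
    · have hQ : x 0 ^ 4 + -k ^ 2 * x 0 ^ 2 + x 1 ^ 2 + x 2 ^ 2 = (x 2 - G) * (x 2 + G) := by
        linear_combination hG2
      rw [phaseV, hQ, abs_of_nonneg (mul_nonneg hl0.le (sq_nonneg _)), ← hlτ]
      refine mul_le_mul_of_nonneg_left (pow_le_pow_left₀ (mul_nonneg (by linarith) (by linarith))
        ?_ 2) hl0.le
      calc (x 2 - G) * (x 2 + G) ≤ (η * τ) * (2 * δ) :=
            mul_le_mul (by linarith) (by linarith) (by linarith) (by positivity)
        _ = η * (2 * δ) * τ := by ring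
        _ ≤ τ := mul_le_of_le_one_left hτ0.le hη2
  · rw [hB, Real.volume_Icc_pi, Fin.prod_univ_two, ← ENNReal.ofReal_mul, ← ENNReal.ofReal_mul]
    · congr 1
      simp
      ring
    · simp
      nlinarith
    · simp
      linarith

/-! ### Smoothness of integrals depending on parameters -/

section parametric

variable {E F : Type} [NormedAddCommGroup E] [NormedSpace ℝ E] [FiniteDimensional ℝ E]
  [NormedAddCommGroup F] [NormedSpace ℝ F]

theorem hasFDerivAt_intervalIntegral_of_contDiff {f : E × ℝ → F} (hf : ContDiff ℝ ∞ f) (a b : ℝ)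
    (x : E) :
    HasFDerivAt (fun x => ∫ t in a..b, f (x, t))
      (∫ t in a..b, (fderiv ℝ f (x, t)).comp (ContinuousLinearMap.inl ℝ E ℝ)) x := by
  have hc := hf.continuous
  have hc' : Continuous fun z : E × ℝ => (fderiv ℝ f z).comp (ContinuousLinearMap.inl ℝ E ℝ) :=
    (hf.continuous_fderiv (by simp)).clm_comp continuous_const
  obtain ⟨C, hC⟩ := ((isCompact_closedBall x 1).prod
    (isCompact_uIcc (a := a) (b := b))).exists_bound_of_continuousOn hc'.continuousOn
  refine intervalIntegral.hasFDerivAt_integral_of_dominated_of_fderiv_le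
    (F' := fun x t => (fderiv ℝ f (x, t)).comp (ContinuousLinearMap.inl ℝ E ℝ))
    (bound := fun _ => C) (Metric.closedBall_mem_nhds x one_pos)
    (Eventually.of_forall fun y => ?_) ?_ ?_ ?_ intervalIntegrable_const ?_
  · exact (hc.comp (by fun_prop : Continuous fun t : ℝ => (y, t))).aestronglyMeasurable
  · exact (hc.comp (by fun_prop : Continuous fun t : ℝ => (x, t))).intervalIntegrable _ _
  · exact (hc'.comp (by fun_prop : Continuous fun t : ℝ => (x, t))).aestronglyMeasurable
  · exact Eventually.of_forall fun t ht y hy => hC (y, t) ⟨hy, Set.uIoc_subset_uIcc ht⟩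
  · refine Eventually.of_forall fun t _ y _ => ?_
    have h1 : HasFDerivAt f (fderiv ℝ f (y, t)) (y, t) :=
      (hf.differentiable (by simp) (y, t)).hasFDerivAt
    have h2 : HasFDerivAt (fun y : E => (y, t)) (ContinuousLinearMap.inl ℝ E ℝ) y :=
      hasFDerivAt_prodMk_left y t
    exact h1.comp y h2

end parametric

theorem contDiff_nat_intervalIntegral {E : Type} [NormedAddCommGroup E] [NormedSpace ℝ E]
    [FiniteDimensional ℝ E] (a b : ℝ) (n : ℕ) :
    ∀ {F : Type} [NormedAddCommGroup F] [NormedSpace ℝ F] {f : E × ℝ → F},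
      ContDiff ℝ ∞ f → ContDiff ℝ n fun x => ∫ t in a..b, f (x, t) := by
  induction n with
  | zero =>
    intro F _ _ f hf
    refine contDiff_zero.2 (continuous_iff_continuousAt.2 fun x => ?_)
    exact (hasFDerivAt_intervalIntegral_of_contDiff hf a b x).continuousAt
  | succ n ih =>
    intro F _ _ f hf
    have hd := hasFDerivAt_intervalIntegral_of_contDiff hf a b
    rw [Nat.cast_succ, contDiff_succ_iff_fderiv]
    refine ⟨fun x => (hd x).differentiableAt, fun h => by simp at h, ?_⟩
    have h1 : fderiv ℝ (fun x => ∫ t in a..b, f (x, t)) = fun x => ∫ t in a..b,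
        (fun z : E × ℝ => (fderiv ℝ f z).comp (ContinuousLinearMap.inl ℝ E ℝ)) (x, t) :=
      funext fun x => (hd x).fderiv
    rw [h1]
    exact ih ((hf.fderiv_right (m := ∞) (by simp)).clm_comp contDiff_const)

/-- An interval integral of a smooth function depends smoothly on parameters. -/
theorem contDiff_intervalIntegral {E F : Type} [NormedAddCommGroup E] [NormedSpace ℝ E]
    [FiniteDimensional ℝ E] [NormedAddCommGroup F] [NormedSpace ℝ F]
    {f : E × ℝ → F} (hf : ContDiff ℝ ∞ f) (a b : ℝ) :
    ContDiff ℝ ∞ fun x => ∫ t in a..b, f (x, t) :=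
  contDiff_infty.2 fun n => contDiff_nat_intervalIntegral a b n hf

/-! ### Reduction to two variables by rotation in the `(y, z)`-plane -/

/-- The integral of `φ` over angles, at height `x` and radius `r`. -/
noncomputable def circleIntegralAt (φ : (Fin 3 → ℝ) → ℝ) (z : ℝ × ℝ) : ℝ :=
  ∫ θ in (-Real.pi)..Real.pi, φ ![z.1, z.2 * Real.cos θ, z.2 * Real.sin θ]

theorem contDiff_vec3 : ContDiff ℝ ∞ fun z : (ℝ × ℝ) × ℝ =>
    (![z.1.1, z.1.2 * Real.cos z.2, z.1.2 * Real.sin z.2] : Fin 3 → ℝ) := by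
  refine contDiff_pi.2 fun i => ?_
  fin_cases i
  · exact contDiff_fst.fst
  · exact contDiff_fst.snd.mul (Real.contDiff_cos.comp contDiff_snd)
  · exact contDiff_fst.snd.mul (Real.contDiff_sin.comp contDiff_snd)

theorem contDiff_circleIntegralAt {φ : (Fin 3 → ℝ) → ℝ} (hφ : ContDiff ℝ ∞ φ) :
    ContDiff ℝ ∞ (circleIntegralAt φ) :=
  contDiff_intervalIntegral (f := fun z : (ℝ × ℝ) × ℝ =>
    φ ![z.1.1, z.1.2 * Real.cos z.2, z.1.2 * Real.sin z.2]) (hφ.comp contDiff_vec3) _ _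

theorem integral_fin_three (f : (Fin 3 → ℝ) → ℂ) :
    ∫ x, f x = ∫ z : ℝ × (ℝ × ℝ), f ![z.1, z.2.1, z.2.2] := by
  have h1 := (volume_preserving_piFinSuccAbove (fun _ : Fin 3 => ℝ) 0)
  have h2 := (MeasurePreserving.id (volume : Measure ℝ)).prod (volume_preserving_finTwoArrow ℝ)
  have h3 : MeasurePreserving ((MeasurableEquiv.piFinSuccAbove (fun _ : Fin 3 => ℝ) 0).trans
      ((MeasurableEquiv.refl ℝ).prodCongr MeasurableEquiv.finTwoArrow)) volume volume :=
    h2.comp h1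
  rw [← h3.integral_comp' (fun z : ℝ × (ℝ × ℝ) => f ![z.1, z.2.1, z.2.2])]
  refine integral_congr_ae (Eventually.of_forall fun x => ?_)
  have : x = ![x 0, x 1, x 2] := by
    funext i
    fin_cases i <;> rfl
  exact congrArg f this

theorem exists_bound_of_hasCompactSupport {φ : (Fin 3 → ℝ) → ℝ} (hc : HasCompactSupport φ) :
    ∃ R > 0, ∀ p, R < ‖p‖ → φ p = 0 := by
  obtain ⟨R, hR⟩ := hc.isCompact.isBounded.exists_norm_le
  refine ⟨max R 1, lt_of_lt_of_le one_pos (le_max_right _ _), fun p hp => ?_⟩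
  by_contra h
  exact absurd (hR p (subset_tsupport _ h)) (not_le.2 ((le_max_left _ _).trans_lt hp))

theorem max_abs_polar_le (ρ θ : ℝ) : |ρ| ≤ 2 * max |ρ * Real.cos θ| |ρ * Real.sin θ| := by
  have h1 := le_max_left |ρ * Real.cos θ| |ρ * Real.sin θ|
  have h2 := le_max_right |ρ * Real.cos θ| |ρ * Real.sin θ|
  set M := max |ρ * Real.cos θ| |ρ * Real.sin θ|
  have hM : 0 ≤ M := (abs_nonneg _).trans h1
  refine abs_le_of_sq_le_sq ?_ (by positivity)
  have h3 := sq_le_sq' (abs_le.1 h1).1 (abs_le.1 h1).2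
  have h4 := sq_le_sq' (abs_le.1 h2).1 (abs_le.1 h2).2
  nlinarith [Real.sin_sq_add_cos_sq θ, sq_nonneg M]

theorem norm_vec3_ge (x y z : ℝ) : |x| ≤ ‖(![x, y, z] : Fin 3 → ℝ)‖ ∧
    |y| ≤ ‖(![x, y, z] : Fin 3 → ℝ)‖ ∧ |z| ≤ ‖(![x, y, z] : Fin 3 → ℝ)‖ :=
  ⟨norm_le_pi_norm (![x, y, z] : Fin 3 → ℝ) 0, norm_le_pi_norm (![x, y, z] : Fin 3 → ℝ) 1,
    norm_le_pi_norm (![x, y, z] : Fin 3 → ℝ) 2⟩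

theorem apply_vec3_polar_eq_zero {φ : (Fin 3 → ℝ) → ℝ} {R : ℝ} (hR : ∀ p, R < ‖p‖ → φ p = 0)
    {x ρ : ℝ} (θ : ℝ) (h : 2 * R < |x| ∨ 2 * R < |ρ|) (hR0 : 0 < R) :
    φ ![x, ρ * Real.cos θ, ρ * Real.sin θ] = 0 := by
  refine hR _ ?_
  obtain ⟨h1, h2, h3⟩ := norm_vec3_ge x (ρ * Real.cos θ) (ρ * Real.sin θ)
  rcases h with h | h
  · linarith
  · have h4 := max_abs_polar_le ρ θ
    have h5 := max_le h2 h3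
    linarith

/-- The function `m` on the plane vanishes outside the square `|x| < R`, `|ρ| < R`. -/
def VanishesOutside (R : ℝ) (m : ℝ × ℝ → ℝ) : Prop :=
  ∀ x ρ, R ≤ |x| ∨ R ≤ |ρ| → m (x, ρ) = 0

theorem hasCompactSupport_of_vanishesOutside {R : ℝ} {m : ℝ × ℝ → ℝ} (h : VanishesOutside R m) :
    HasCompactSupport m := by
  refine HasCompactSupport.intro ((isCompact_Icc (a := -R) (b := R)).prod
    (isCompact_Icc (a := -R) (b := R))) ?_
  rintro ⟨x, ρ⟩ hz
  by_contra hne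
  refine hz ⟨abs_le.1 ?_, abs_le.1 ?_⟩
  · by_contra hx
    exact hne (h x ρ (Or.inl (not_le.1 hx).le))
  · by_contra hx
    exact hne (h x ρ (Or.inr (not_le.1 hx).le))

/-- The oscillatory integrand in the variables `x` and `ρ`, with phase `(Q(x, ρ))²` and the area
element `ρ dρ dx`. -/
noncomputable def planarIntegrand (Q : ℝ × ℝ → ℝ) (m : ℝ × ℝ → ℝ) (l : ℝ) (z : ℝ × ℝ) : ℂ :=
  Complex.exp (Complex.I * ((l * Q z ^ 2 : ℝ) : ℂ)) * ((z.2 * m z : ℝ) : ℂ)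

theorem integrable_planarIntegrand {Q m : ℝ × ℝ → ℝ} (hQ : Continuous Q) (hm : Continuous m)
    {R : ℝ} (hR : VanishesOutside R m) (l : ℝ) : Integrable (planarIntegrand Q m l) := by
  refine Continuous.integrable_of_hasCompactSupport ?_ ?_
  · unfold planarIntegrand
    fun_prop
  · refine (hasCompactSupport_of_vanishesOutside hR).mono fun z hz => ?_
    simp only [Function.mem_support, planarIntegrand] at hz ⊢
    intro h
    simp [h] at hz

/-- Polar coordinates in the plane for a rotationally invariant phase. -/
theorem integral_polar {q : ℝ → ℝ} (hq : Continuous q) {f : ℝ × ℝ → ℝ} (hf : Continuous f) {R : ℝ}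
    (hR : ∀ ρ θ, R < |ρ| → f (ρ * Real.cos θ, ρ * Real.sin θ) = 0) (l : ℝ) :
    ∫ z : ℝ × ℝ, Complex.exp (Complex.I * ((l * q (z.1 ^ 2 + z.2 ^ 2) : ℝ) : ℂ)) * ((f z : ℝ) : ℂ) =
      ∫ ρ in Set.Ioi (0 : ℝ), Complex.exp (Complex.I * ((l * q (ρ ^ 2) : ℝ) : ℂ)) *
        ((ρ * ∫ θ in (-Real.pi)..Real.pi, f (ρ * Real.cos θ, ρ * Real.sin θ) : ℝ) : ℂ) := by
  rw [← integral_comp_polarCoord_symm, polarCoord_target]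
  set k : ℝ × ℝ → ℂ := fun z => Complex.exp (Complex.I * ((l * q (z.1 ^ 2) : ℝ) : ℂ)) *
    ((z.1 * f (z.1 * Real.cos z.2, z.1 * Real.sin z.2) : ℝ) : ℂ) with hk
  have hkc : Continuous k := by
    simp only [hk]
    fun_prop
  have h1 : ∀ p : ℝ × ℝ, p.1 • (Complex.exp (Complex.I *
      ((l * q ((polarCoord.symm p).1 ^ 2 + (polarCoord.symm p).2 ^ 2) : ℝ) : ℂ)) *
        ((f (polarCoord.symm p) : ℝ) : ℂ)) = k p := by
    intro p
    have h2 : (p.1 * Real.cos p.2) ^ 2 + (p.1 * Real.sin p.2) ^ 2 = p.1 ^ 2 := by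
      linear_combination p.1 ^ 2 * Real.sin_sq_add_cos_sq p.2
    simp only [polarCoord_symm_apply, h2, hk, Complex.real_smul]
    push_cast
    ring
  simp only [h1]
  have hint : IntegrableOn k (Set.Ioi 0 ×ˢ Set.Ioo (-Real.pi) Real.pi) := by
    refine IntegrableOn.of_forall_sdiff_eq_zero (s := Set.Icc 0 R ×ˢ Set.Icc (-Real.pi) Real.pi)
      (hkc.continuousOn.integrableOn_compact (isCompact_Icc.prod isCompact_Icc))
      (measurableSet_Ioi.prod measurableSet_Ioo) ?_
    rintro ⟨ρ, θ⟩ ⟨⟨h2, h3⟩, h4⟩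
    have h5 : R < |ρ| := by
      by_contra h5
      exact h4 ⟨⟨(Set.mem_Ioi.1 h2).le, (le_abs_self ρ).trans (not_lt.1 h5)⟩, h3.1.le, h3.2.le⟩
    simp only [hk, hR ρ θ h5]
    simp
  rw [Measure.volume_eq_prod] at hint ⊢
  rw [setIntegral_prod _ hint]
  refine setIntegral_congr_fun measurableSet_Ioi fun ρ _ => ?_
  simp only [hk]
  rw [integral_const_mul, integral_complex_ofReal, integral_const_mul,
    ← integral_Ioc_eq_integral_Ioo, intervalIntegral.integral_of_le (by linarith [Real.pi_pos])]

/-- The oscillatory integral of a phase `(P(x) + y² + z²)²` with `P` even, as an integral over a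
quadrant. -/
theorem exists_planar_reduction {P : ℝ → ℝ} (hP : Continuous P) (hPe : ∀ x, P (-x) = P x)
    {φ : (Fin 3 → ℝ) → ℝ} (hφ : ContDiff ℝ ∞ φ) (hc : HasCompactSupport φ) :
    ∃ m : ℝ × ℝ → ℝ, ContDiff ℝ ∞ m ∧ (∃ R > 0, VanishesOutside R m) ∧
      (∀ δ, (∀ p, δ ≤ |p 0| → φ p = 0) → ∀ x ρ, δ ≤ |x| → m (x, ρ) = 0) ∧
      ∀ l, oscillatoryIntegral (fun p => (P (p 0) + p 1 ^ 2 + p 2 ^ 2) ^ 2) φ l =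
        ∫ x in Set.Ioi (0 : ℝ), ∫ ρ in Set.Ioi (0 : ℝ),
          planarIntegrand (fun z => P z.1 + z.2 ^ 2) m l (x, ρ) := by
  obtain ⟨R, hR0, hR⟩ := exists_bound_of_hasCompactSupport hc
  have hcirc := contDiff_circleIntegralAt hφ
  have hv : VanishesOutside (3 * R) (circleIntegralAt φ) := by
    intro x ρ h
    unfold circleIntegralAt
    simp only
    have : ∀ θ, φ ![x, ρ * Real.cos θ, ρ * Real.sin θ] = 0 := fun θ =>
      apply_vec3_polar_eq_zero hR θ (h.imp (fun h => by linarith) (fun h => by linarith)) hR0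
    simp [this]
  set m : ℝ × ℝ → ℝ := fun z => circleIntegralAt φ z + circleIntegralAt φ (-z.1, z.2) with hm
  have hneg : ContDiff ℝ ∞ fun z : ℝ × ℝ => ((-z.1, z.2) : ℝ × ℝ) :=
    contDiff_fst.neg.prodMk contDiff_snd
  refine ⟨m, hcirc.add (hcirc.comp hneg), ⟨3 * R, by linarith, fun x ρ h => ?_⟩, ?_, ?_⟩
  · simp only [hm]
    rw [hv x ρ h, hv (-x) ρ (by rwa [abs_neg]), add_zero]
  · intro δ hδ x ρ hx
    have h1 : ∀ x', |x'| = |x| → circleIntegralAt φ (x', ρ) = 0 := by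
      intro x' hx'
      unfold circleIntegralAt
      simp only
      have : ∀ θ, φ ![x', ρ * Real.cos θ, ρ * Real.sin θ] = 0 := fun θ => hδ _ (by
        simpa [hx'] using hx)
      simp [this]
    simp only [hm]
    rw [h1 x rfl, h1 (-x) (abs_neg x), add_zero]
  · intro l
    set Q : ℝ × ℝ → ℝ := fun z => P z.1 + z.2 ^ 2 with hQ
    have hQc : Continuous Q := by
      simp only [hQ]
      fun_prop
    have hφc := hφ.continuous
    have hvec : Continuous fun z : ℝ × (ℝ × ℝ) => (![z.1, z.2.1, z.2.2] : Fin 3 → ℝ) := by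
      refine continuous_pi fun i => ?_
      fin_cases i
      · exact continuous_fst
      · exact continuous_snd.fst
      · exact continuous_snd.snd
    set g : ℝ → ℂ := fun x =>
      ∫ ρ in Set.Ioi (0 : ℝ), planarIntegrand Q (circleIntegralAt φ) l (x, ρ) with hg
    have hint : ∀ x, IntegrableOn
        (fun ρ => planarIntegrand Q (circleIntegralAt φ) l (x, ρ)) (Set.Ioi 0) := by
      intro x
      refine Integrable.integrableOn (Continuous.integrable_of_hasCompactSupport ?_ ?_)
      · have := hcirc.continuous
        unfold planarIntegrand
        fun_prop
      · refine HasCompactSupport.intro (isCompact_Icc (a := -(3 * R)) (b := 3 * R)) fun ρ hρ => ?_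
        have h1 : 3 * R ≤ |ρ| := by
          by_contra h
          exact hρ (abs_le.1 (not_le.1 h).le)
        simp [planarIntegrand, hv x ρ (Or.inr h1)]
    have hgint : Integrable g := by
      have h1 := integrable_planarIntegrand hQc hcirc.continuous hv l
      have h2 : IntegrableOn (planarIntegrand Q (circleIntegralAt φ) l)
        (Set.univ ×ˢ Set.Ioi 0) := h1.integrableOn
      rw [Measure.volume_eq_prod, IntegrableOn, ← Measure.prod_restrict,
        Measure.restrict_univ] at h2
      exact h2.integral_prod_left
    have hJ : oscillatoryIntegral (fun p => (P (p 0) + p 1 ^ 2 + p 2 ^ 2) ^ 2) φ l = ∫ x, g x := by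
      have hi : Integrable fun z : ℝ × (ℝ × ℝ) =>
          Complex.exp (Complex.I * ((l * (P z.1 + z.2.1 ^ 2 + z.2.2 ^ 2) ^ 2 : ℝ) : ℂ)) *
            ((φ ![z.1, z.2.1, z.2.2] : ℝ) : ℂ) := by
        refine Continuous.integrable_of_hasCompactSupport (by fun_prop) ?_
        refine HasCompactSupport.intro ((isCompact_Icc (a := -R) (b := R)).prod
          ((isCompact_Icc (a := -R) (b := R)).prod (isCompact_Icc (a := -R) (b := R)))) ?_
        rintro ⟨x, y, z⟩ hz
        obtain ⟨h1, h2, h3⟩ := norm_vec3_ge x y z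
        have : φ ![x, y, z] = 0 := by
          refine hR _ ?_
          by_contra h
          rw [not_lt] at h
          exact hz ⟨abs_le.1 (h1.trans h), abs_le.1 (h2.trans h), abs_le.1 (h3.trans h)⟩
        simp [this]
      rw [oscillatoryIntegral, integral_fin_three]
      simp only [Matrix.cons_val_zero, Matrix.cons_val_one, Matrix.cons_val]
      rw [Measure.volume_eq_prod] at hi ⊢
      rw [integral_prod _ hi]
      refine integral_congr_ae (Eventually.of_forall fun x => ?_)
      have h1 := integral_polar (q := fun s => (P x + s) ^ 2) (by fun_prop)
        (f := fun z => φ ![x, z.1, z.2]) (by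
          exact hφc.comp (hvec.comp (by fun_prop : Continuous fun z : ℝ × ℝ => (x, z))))
        (R := 2 * R) (fun ρ θ h => apply_vec3_polar_eq_zero hR θ (Or.inr h) hR0) l
      simp only [add_assoc]
      exact h1
    rw [hJ, ← intervalIntegral.integral_Iic_add_Ioi (b := 0) hgint.integrableOn hgint.integrableOn]
    have h1 : ∫ x in Set.Iic (0 : ℝ), g x = ∫ x in Set.Ioi (0 : ℝ), g (-x) := by
      simp
    rw [h1, ← integral_add hgint.comp_neg.integrableOn hgint.integrableOn]
    refine setIntegral_congr_fun measurableSet_Ioi fun x _ => ?_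
    simp only [hg]
    rw [← integral_add (hint (-x)) (hint x)]
    refine setIntegral_congr_fun measurableSet_Ioi fun ρ _ => ?_
    simp only [planarIntegrand, hQ, hPe, hm]
    push_cast
    ring

/-! ### Quasi-homogeneous coordinates in the quadrant -/

/-- The chart `(w, r) ↦ (r A(w), r^κ B(w))` of quasi-homogeneous polar coordinates. -/
def quasiPolar (A B : ℝ → ℝ) (κ : ℕ) (z : ℝ × ℝ) : ℝ × ℝ :=
  (z.2 * A z.1, z.2 ^ κ * B z.1)

theorem hasFDerivAt_quasiPolar {A B : ℝ → ℝ} (hA : Differentiable ℝ A) (hB : Differentiable ℝ B)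
    (κ : ℕ) (z : ℝ × ℝ) :
    HasFDerivAt (quasiPolar A B κ)
      (Matrix.toLin (.finTwoProd ℝ) (.finTwoProd ℝ)
        !![z.2 * deriv A z.1, A z.1; z.2 ^ κ * deriv B z.1,
          κ * z.2 ^ (κ - 1) * B z.1]).toContinuousLinearMap z := by
  rw [Matrix.toLin_finTwoProd_toContinuousLinearMap]
  have h1 : HasFDerivAt (fun z : ℝ × ℝ => A z.1) (deriv A z.1 • ContinuousLinearMap.fst ℝ ℝ ℝ) z :=
    ((hA z.1).hasDerivAt).comp_hasFDerivAt z hasFDerivAt_fst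
  have h2 : HasFDerivAt (fun z : ℝ × ℝ => B z.1) (deriv B z.1 • ContinuousLinearMap.fst ℝ ℝ ℝ) z :=
    ((hB z.1).hasDerivAt).comp_hasFDerivAt z hasFDerivAt_fst
  have h3 : HasFDerivAt (fun z : ℝ × ℝ => z.2 ^ κ)
      ((κ * z.2 ^ (κ - 1)) • ContinuousLinearMap.snd ℝ ℝ ℝ) z :=
    (hasDerivAt_pow κ z.2).comp_hasFDerivAt z hasFDerivAt_snd
  have h4 : HasFDerivAt (fun z : ℝ × ℝ => z.2) (ContinuousLinearMap.snd ℝ ℝ ℝ) z := hasFDerivAt_snd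
  refine ((h4.mul h1).prodMk (h3.mul h2)).congr_fderiv ?_
  refine ContinuousLinearMap.ext fun v => ?_
  ext
  · simp
    ring
  · simp
    ring

theorem det_quasiPolar {κ : ℕ} (hκ : 1 ≤ κ) (r a b a' b' : ℝ) :
    ((Matrix.toLin (.finTwoProd ℝ) (.finTwoProd ℝ)
        !![r * a', a; r ^ κ * b', κ * r ^ (κ - 1) * b]).toContinuousLinearMap).det =
      -(r ^ κ * (a * b' - κ * a' * b)) := by
  obtain ⟨κ, rfl⟩ : ∃ k, κ = k + 1 := ⟨κ - 1, by omega⟩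
  simp only [LinearMap.det_toContinuousLinearMap, LinearMap.det_toLin, Matrix.det_fin_two_of,
    Nat.add_sub_cancel]
  ring

/-- In a chart in which the phase becomes a monomial, the planar integral is an integral with
monomial phase, whose amplitude contains the factor `r^(2κ)` from the area element `ρ dρ dx`. -/
theorem exists_monoInt_of_quasiPolar {A B W : ℝ → ℝ} (hA : ContDiff ℝ ∞ A) (hB : ContDiff ℝ ∞ B)
    (hW : ContDiff ℝ ∞ W) {κ : ℕ} (hκ : 1 ≤ κ) {p q : ℕ} {w₀ w₁ : ℝ} (hw : w₀ ≤ w₁)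
    {Q : ℝ × ℝ → ℝ} (hQ : Continuous Q)
    (hbij : Set.BijOn (quasiPolar A B κ) (Set.Ioo w₀ w₁ ×ˢ Set.Ioi 0) (Set.Ioi 0 ×ˢ Set.Ioi 0))
    (hdens : ∀ w ∈ Set.Ioo w₀ w₁, B w * |A w * deriv B w - κ * deriv A w * B w| = W w)
    (hphase : ∀ w ∈ Set.Ioo w₀ w₁, ∀ r > 0, Q (quasiPolar A B κ (w, r)) ^ 2 = w ^ p * r ^ q)
    (hproper : ∀ R > 0, ∃ R' > 0, ∀ w r, R' ≤ r → R ≤ |r * A w| ∨ R ≤ |r ^ κ * B w|)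
    {m : ℝ × ℝ → ℝ} (hm : ContDiff ℝ ∞ m) {R : ℝ} (hR0 : 0 < R) (hR : VanishesOutside R m) :
    ∃ (R' : ℝ) (G : ℝ × ℝ → ℂ), SmoothBelow R' G ∧
      ∀ l, ∫ x in Set.Ioi (0 : ℝ), ∫ ρ in Set.Ioi (0 : ℝ), planarIntegrand Q m l (x, ρ) =
        monoInt p q w₀ w₁ R' (fun z => (z.2 : ℂ) ^ (2 * κ) * G z) l := by
  obtain ⟨R', hR'0, hR'⟩ := hproper R hR0
  set G : ℝ × ℝ → ℂ := fun z => ((W z.1 * m (quasiPolar A B κ z) : ℝ) : ℂ) with hG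
  have hψ : ContDiff ℝ ∞ (quasiPolar A B κ) :=
    (contDiff_snd.mul (hA.comp contDiff_fst)).prodMk
      ((contDiff_snd.pow κ).mul (hB.comp contDiff_fst))
  have hGs : SmoothBelow R' G := by
    refine ⟨Complex.ofRealCLM.contDiff.comp ((hW.comp contDiff_fst).mul (hm.comp hψ)), ?_⟩
    intro w r hr
    simp only [hG, quasiPolar]
    rw [hR _ _ (hR' w r hr)]
    simp
  refine ⟨R', G, hGs, fun l => ?_⟩
  have hint := integrable_planarIntegrand hQ hm.continuous hR l
  have hpos : MeasurableSet (Set.Ioo w₀ w₁ ×ˢ Set.Ioi (0 : ℝ)) :=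
    measurableSet_Ioo.prod measurableSet_Ioi
  have h1 := setIntegral_prod (s := Set.Ioi (0 : ℝ)) (t := Set.Ioi (0 : ℝ))
    (μ := volume) (ν := volume) (planarIntegrand Q m l) (by
      rw [← Measure.volume_eq_prod]; exact hint.integrableOn)
  rw [← h1, ← Measure.volume_eq_prod, ← hbij.image_eq,
    integral_image_eq_integral_abs_det_fderiv_smul volume hpos
      (fun z _ => (hasFDerivAt_quasiPolar (hA.differentiable (by simp))
        (hB.differentiable (by simp)) κ z).hasFDerivWithinAt) hbij.injOn]
  set H : ℝ × ℝ → ℂ := fun z => monoExp p q l z.1 z.2 * ((z.2 : ℂ) ^ (2 * κ) * G z) with hH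
  have hHc : Continuous H := by
    have h2 := (continuous_monoExp p q).comp
      (by fun_prop : Continuous fun z : ℝ × ℝ => (l, z.1, z.2))
    have h3 := hGs.1.continuous
    exact h2.mul (by fun_prop)
  have h2 : ∀ z ∈ Set.Ioo w₀ w₁ ×ˢ Set.Ioi (0 : ℝ),
      |((Matrix.toLin (.finTwoProd ℝ) (.finTwoProd ℝ)
        !![z.2 * deriv A z.1, A z.1; z.2 ^ κ * deriv B z.1,
          κ * z.2 ^ (κ - 1) * B z.1]).toContinuousLinearMap).det| •
        planarIntegrand Q m l (quasiPolar A B κ z) = H z := by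
    rintro ⟨w, r⟩ ⟨hw', hr⟩
    have hr0 : 0 < r := hr
    have hp := hphase w hw' r hr0
    have hd := hdens w hw'
    rw [det_quasiPolar hκ, abs_neg, abs_mul, abs_of_pos (pow_pos hr0 κ)]
    simp only [planarIntegrand, hH, hG, hp, monoExp, Complex.real_smul]
    rw [← hd]
    simp only [quasiPolar]
    push_cast
    ring
  rw [setIntegral_congr_fun hpos h2]
  have h3 : Set.Ioo w₀ w₁ ×ˢ Set.Ioc 0 R' ⊆ Set.Ioo w₀ w₁ ×ˢ Set.Ioi (0 : ℝ) :=
    Set.prod_mono le_rfl Set.Ioc_subset_Ioi_self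
  rw [setIntegral_eq_of_subset_of_forall_sdiff_eq_zero hpos h3]
  · have h4 : IntegrableOn H (Set.Ioo w₀ w₁ ×ˢ Set.Ioc 0 R') :=
      (hHc.continuousOn.integrableOn_compact (isCompact_Icc.prod isCompact_Icc)).mono_set
        (Set.prod_mono Set.Ioo_subset_Icc_self Set.Ioc_subset_Icc_self)
    rw [Measure.volume_eq_prod] at h4 ⊢
    rw [setIntegral_prod _ h4, monoInt, intervalIntegral.integral_of_le hw,
      integral_Ioc_eq_integral_Ioo]
    refine setIntegral_congr_fun measurableSet_Ioo fun w _ => ?_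
    simp only
    rw [intervalIntegral.integral_of_le hR'0.le]
  · rintro ⟨w, r⟩ ⟨⟨h5, h6⟩, h7⟩
    have h8 : R' ≤ r := by
      by_contra h8
      exact h7 ⟨h5, h6, (not_le.1 h8).le⟩
    simp [hH, hGs.2 w r h8]

/-- Coordinates `x = r sin w`, `ρ = r^κ B(w)` with `sin^(2κ) + B² = 1`, for the phase
`(x^(2κ) + ρ²)² = r^(4κ)`. -/
theorem exists_monoInt_definite {κ : ℕ} (hκ : 1 ≤ κ) {B : ℝ → ℝ} (hB : ContDiff ℝ ∞ B)
    (hB0 : ∀ w ∈ Set.Ioo 0 (Real.pi / 2), 0 < B w)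
    (hsum : ∀ w, Real.sin w ^ (2 * κ) + B w ^ 2 = 1)
    {m : ℝ × ℝ → ℝ} (hm : ContDiff ℝ ∞ m) {R : ℝ} (hR0 : 0 < R) (hR : VanishesOutside R m) :
    ∃ (R' : ℝ) (G : ℝ × ℝ → ℂ), SmoothBelow R' G ∧
      ∀ l, ∫ x in Set.Ioi (0 : ℝ), ∫ ρ in Set.Ioi (0 : ℝ),
        planarIntegrand (fun z => z.1 ^ (2 * κ) + z.2 ^ 2) m l (x, ρ) =
        monoInt 0 (4 * κ) 0 (Real.pi / 2) R' (fun z => (z.2 : ℂ) ^ (2 * κ) * G z) l := by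
  have hpi := Real.pi_pos
  have hκ0 : 2 * κ ≠ 0 := by omega
  have hsum' : ∀ w r, (r * Real.sin w) ^ (2 * κ) + (r ^ κ * B w) ^ 2 = r ^ (2 * κ) := by
    intro w r
    calc _ = r ^ (2 * κ) * (Real.sin w ^ (2 * κ) + B w ^ 2) := by rw [mul_pow, mul_pow]; ring
      _ = _ := by rw [hsum, mul_one]
  have hsin : ∀ w ∈ Set.Ioo 0 (Real.pi / 2), 0 < Real.sin w := fun w hw =>
    Real.sin_pos_of_pos_of_lt_pi hw.1 (by linarith [hw.2])
  refine exists_monoInt_of_quasiPolar (W := fun w => κ * Real.cos w) Real.contDiff_sin hB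
    (contDiff_const.mul Real.contDiff_cos) hκ (by linarith) (by fun_prop) ⟨?_, ?_, ?_⟩ ?_ ?_ ?_
    hm hR0 hR
  · rintro ⟨w, r⟩ ⟨hw, hr⟩
    exact ⟨mul_pos hr (hsin w hw), mul_pos (pow_pos hr κ) (hB0 w hw)⟩
  · rintro ⟨w, r⟩ ⟨hw, hr⟩ ⟨w', r'⟩ ⟨hw', hr'⟩ heq
    simp only [quasiPolar, Prod.mk.injEq] at heq
    have h1 : r ^ (2 * κ) = r' ^ (2 * κ) := by
      rw [← hsum' w r, ← hsum' w' r', heq.1, heq.2]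
    have h2 : r = r' := (pow_left_inj₀ (le_of_lt hr) (le_of_lt hr') hκ0).1 h1
    subst h2
    have h3 : Real.sin w = Real.sin w' := mul_left_cancel₀ (ne_of_gt hr) heq.1
    have h4 := Real.injOn_sin ⟨by linarith [hw.1], hw.2.le⟩ ⟨by linarith [hw'.1], hw'.2.le⟩ h3
    exact Prod.ext h4 rfl
  · rintro ⟨u, ρ⟩ ⟨hu, hρ⟩
    have hu0 : 0 < u := hu
    have hρ0 : 0 < ρ := hρ
    have hs0 : 0 < u ^ (2 * κ) + ρ ^ 2 := by positivity
    obtain ⟨r, hr0, hr⟩ : ∃ r : ℝ, 0 < r ∧ r ^ (2 * κ) = u ^ (2 * κ) + ρ ^ 2 :=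
      ⟨_, Real.rpow_pos_of_pos hs0 _, Real.rpow_inv_natCast_pow hs0.le hκ0⟩
    have hur : u < r := lt_of_pow_lt_pow_left₀ (2 * κ) hr0.le (by rw [hr]; nlinarith)
    have hd0 : 0 < u / r := by positivity
    have hd1 : u / r < 1 := (div_lt_one hr0).2 hur
    have hw : Real.arcsin (u / r) ∈ Set.Ioo 0 (Real.pi / 2) :=
      ⟨Real.arcsin_pos.2 hd0, Real.arcsin_lt_pi_div_two.2 hd1⟩
    have hs : Real.sin (Real.arcsin (u / r)) = u / r :=
      Real.sin_arcsin (by linarith) hd1.le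
    have h1 : r * Real.sin (Real.arcsin (u / r)) = u := by
      rw [hs]
      field_simp
    refine ⟨(Real.arcsin (u / r), r), ⟨hw, hr0⟩, Prod.ext h1 ?_⟩
    have h2 := hsum' (Real.arcsin (u / r)) r
    rw [h1, hr] at h2
    exact (pow_left_inj₀ (mul_pos (pow_pos hr0 κ) (hB0 _ hw)).le hρ0.le two_ne_zero).1
      (by linarith)
  · intro w hw
    -- Differentiating `sin^(2κ) + B² = 1` shows that `B` times the Jacobian is `-κ cos w`.
    have hd := ((hB.differentiable (by simp) w).hasDerivAt)
    have h1 : HasDerivAt (fun w => Real.sin w ^ (2 * κ) + B w ^ 2)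
        ((2 * κ : ℕ) * Real.sin w ^ (2 * κ - 1) * Real.cos w +
          (2 : ℕ) * B w ^ (2 - 1) * deriv B w) w :=
      ((Real.hasDerivAt_sin w).pow _).add (hd.pow 2)
    have h2 : (fun w => Real.sin w ^ (2 * κ) + B w ^ 2) = fun _ => 1 := funext hsum
    rw [h2] at h1
    have h3 := h1.unique (hasDerivAt_const w 1)
    have hcos : 0 ≤ Real.cos w :=
      Real.cos_nonneg_of_mem_Icc ⟨by linarith [hw.1], hw.2.le⟩
    have h4 : B w * (Real.sin w * deriv B w - κ * deriv Real.sin w * B w) = -(κ * Real.cos w) := by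
      rw [Real.deriv_sin]
      obtain ⟨k, rfl⟩ : ∃ k, κ = k + 1 := ⟨κ - 1, by omega⟩
      have h5 := hsum w
      rw [show 2 * (k + 1) - 1 = 2 * k + 1 by omega] at h3
      push_cast at h3 ⊢
      rw [show 2 * (k + 1) = 2 * k + 1 + 1 by ring, pow_succ] at h5
      simp only [pow_one] at h3
      linear_combination Real.sin w / 2 * h3 - ((k : ℝ) + 1) * Real.cos w * h5
    rw [← abs_of_pos (hB0 w hw), ← abs_mul, abs_of_pos (hB0 w hw), h4, abs_neg,
      abs_of_nonneg (by positivity)]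
  · intro w _ r _
    simp only [quasiPolar]
    rw [hsum', pow_zero, one_mul]
    ring
  · intro R hR0
    refine ⟨max 1 (R ^ (2 * κ) + R ^ 2), by positivity, fun w r hr => ?_⟩
    by_contra! hcon
    have hr1 : 1 ≤ r := (le_max_left _ _).trans hr
    have hr2 := (le_max_right _ _).trans hr
    have h1 : (r * Real.sin w) ^ (2 * κ) ≤ R ^ (2 * κ) := by
      rw [← (even_two_mul κ).pow_abs]
      exact pow_le_pow_left₀ (abs_nonneg _) hcon.1.le _
    have h2 : (r ^ κ * B w) ^ 2 < R ^ 2 := by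
      rw [← sq_abs]
      exact pow_lt_pow_left₀ hcon.2 (abs_nonneg _) two_ne_zero
    have h3 := hsum' w r
    have h4 : r ≤ r ^ (2 * κ) := le_self_pow₀ hr1 hκ0
    linarith

/-- Coordinates `x = r (1 - w) / 2`, `ρ = r (1 + w) / 2`, for the phase `(ρ² - x²)² = w² r⁴`. -/
theorem exists_monoInt_indefinite {m : ℝ × ℝ → ℝ} (hm : ContDiff ℝ ∞ m) {R : ℝ} (hR0 : 0 < R)
    (hR : VanishesOutside R m) :
    ∃ (R' : ℝ) (G : ℝ × ℝ → ℂ), SmoothBelow R' G ∧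
      ∀ l, ∫ x in Set.Ioi (0 : ℝ), ∫ ρ in Set.Ioi (0 : ℝ),
        planarIntegrand (fun z => -z.1 ^ 2 + z.2 ^ 2) m l (x, ρ) =
        monoInt 2 4 (-1) 1 R' (fun z => (z.2 : ℂ) ^ 2 * G z) l := by
  have hA : ∀ w : ℝ, HasDerivAt (fun w : ℝ => (1 - w) / 2) (-1 / 2) w := fun w =>
    ((hasDerivAt_id w).const_sub 1).div_const 2
  have hB : ∀ w : ℝ, HasDerivAt (fun w : ℝ => (1 + w) / 2) (1 / 2) w := fun w =>
    ((hasDerivAt_id w).const_add 1).div_const 2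
  refine exists_monoInt_of_quasiPolar (A := fun w => (1 - w) / 2) (B := fun w => (1 + w) / 2)
    (W := fun w => (1 + w) / 4) (κ := 1) (by fun_prop) (by fun_prop) (by fun_prop) le_rfl
    (by norm_num) (by fun_prop) ⟨?_, ?_, ?_⟩ ?_ ?_ ?_ hm hR0 hR
  · rintro ⟨w, r⟩ ⟨hw, hr⟩
    have hr0 : 0 < r := hr
    have hw1 : -1 < w := hw.1
    have hw2 : w < 1 := hw.2
    refine ⟨mul_pos hr0 ?_, mul_pos (pow_pos hr0 1) ?_⟩ <;> simp only <;> linarith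
  · rintro ⟨w, r⟩ ⟨hw, hr⟩ ⟨w', r'⟩ ⟨hw', hr'⟩ heq
    simp only [quasiPolar, Prod.mk.injEq, pow_one] at heq
    have h2 : r = r' := by linarith [heq.1, heq.2]
    subst h2
    have h3 := mul_left_cancel₀ (ne_of_gt hr) heq.1
    have h4 : w = w' := by linarith
    rw [h4]
  · rintro ⟨u, ρ⟩ ⟨hu, hρ⟩
    have hu0 : 0 < u := hu
    have hρ0 : 0 < ρ := hρ
    refine ⟨((ρ - u) / (ρ + u), u + ρ), ⟨⟨?_, ?_⟩, add_pos hu0 hρ0⟩, Prod.ext ?_ ?_⟩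
    · rw [lt_div_iff₀ (by positivity)]
      linarith
    · rw [div_lt_one (by positivity)]
      linarith
    · simp only [quasiPolar]
      field_simp
      ring
    · simp only [quasiPolar]
      field_simp
      ring
  · intro w hw
    rw [(hA w).deriv, (hB w).deriv]
    have h1 : (1 - w) / 2 * (1 / 2) - ((1 : ℕ) : ℝ) * (-1 / 2) * ((1 + w) / 2) = 1 / 2 := by
      push_cast
      ring
    rw [h1, abs_of_pos (by norm_num)]
    ring
  · intro w _ r _
    simp only [quasiPolar]
    ring
  · intro R hR0
    refine ⟨2 * R, by positivity, fun w r hr => ?_⟩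
    by_contra! hcon
    have h1 := (abs_lt.1 hcon.1).2
    have h2 := (abs_lt.1 hcon.2).2
    simp only [pow_one] at h2
    linarith

/-! ### Straightening the phase in the variable `x` -/

/-- The substitution `x = X(u)` that turns `P(x)` into `σ u²` on the support of the amplitude. -/
theorem exists_planar_subst {X : ℝ → ℝ} (hX : ContDiff ℝ ∞ X) {P : ℝ → ℝ} {σ b δ : ℝ} (hσ : σ ≠ 0)
    (hb : 0 < b) (hX0 : ∀ u ∈ Set.Ioo 0 b, 0 < X u) (hX' : ∀ u ∈ Set.Ioo 0 b, 0 ≤ deriv X u)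
    (hPX : ∀ u ∈ Set.Ioo 0 b, P (X u) = σ * u ^ 2)
    (hsurj : ∀ x ∈ Set.Ioo 0 δ, ∃ u ∈ Set.Ioo 0 b, X u = x) (hout : ∀ u, b ≤ |u| → δ ≤ |X u|)
    {m : ℝ × ℝ → ℝ} (hm : ContDiff ℝ ∞ m) {R : ℝ} (hR : VanishesOutside R m)
    (hδ : ∀ x ρ, δ ≤ |x| → m (x, ρ) = 0) :
    ∃ m₁ : ℝ × ℝ → ℝ, ContDiff ℝ ∞ m₁ ∧ (∃ R₁ > 0, VanishesOutside R₁ m₁) ∧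
      ∀ l, ∫ x in Set.Ioi (0 : ℝ), ∫ ρ in Set.Ioi (0 : ℝ),
          planarIntegrand (fun z => P z.1 + z.2 ^ 2) m l (x, ρ) =
        ∫ x in Set.Ioi (0 : ℝ), ∫ ρ in Set.Ioi (0 : ℝ),
          planarIntegrand (fun z => σ * z.1 ^ 2 + z.2 ^ 2) m₁ l (x, ρ) := by
  set m₁ : ℝ × ℝ → ℝ := fun z => deriv X z.1 * m (X z.1, z.2) with hm₁
  have hX'c : ContDiff ℝ ∞ (deriv X) := (contDiff_infty_iff_deriv.1 hX).2
  refine ⟨m₁, (hX'c.comp contDiff_fst).mul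
    (hm.comp ((hX.comp contDiff_fst).prodMk contDiff_snd)),
    ⟨max b R, lt_max_of_lt_left hb, fun u ρ h => ?_⟩, fun l => ?_⟩
  · have : m (X u, ρ) = 0 := by
      rcases h with h | h
      · exact hδ _ _ (hout u ((le_max_left _ _).trans h))
      · exact hR _ _ (Or.inr ((le_max_right _ _).trans h))
    simp only [hm₁, this, mul_zero]
  · set g : ℝ → ℂ := fun x => ∫ ρ in Set.Ioi (0 : ℝ),
      planarIntegrand (fun z => P z.1 + z.2 ^ 2) m l (x, ρ) with hg
    have hg0 : ∀ x, δ ≤ |x| → g x = 0 := by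
      intro x hx
      simp [hg, planarIntegrand, hδ x _ hx]
    have himg : X '' Set.Ioo 0 b ⊆ Set.Ioi 0 := by
      rintro _ ⟨u, hu, rfl⟩
      exact hX0 u hu
    have hinj : Set.InjOn X (Set.Ioo 0 b) := by
      intro u hu v hv huv
      have h1 := hPX u hu
      rw [huv, hPX v hv] at h1
      exact ((pow_left_inj₀ hv.1.le hu.1.le two_ne_zero).1 (mul_left_cancel₀ hσ h1)).symm
    rw [setIntegral_eq_of_subset_of_forall_sdiff_eq_zero measurableSet_Ioi himg,
      integral_image_eq_integral_abs_deriv_smul measurableSet_Ioo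
        (fun u _ => ((hX.differentiable (by simp) u).hasDerivAt).hasDerivWithinAt) hinj]
    · rw [setIntegral_eq_of_subset_of_forall_sdiff_eq_zero (s := Set.Ioo 0 b) measurableSet_Ioi
        Set.Ioo_subset_Ioi_self]
      · refine setIntegral_congr_fun measurableSet_Ioo fun u hu => ?_
        rw [abs_of_nonneg (hX' u hu), Complex.real_smul, ← integral_const_mul]
        refine setIntegral_congr_fun measurableSet_Ioi fun ρ _ => ?_
        simp only [planarIntegrand, hm₁, hPX u hu]
        push_cast
        ring
      · rintro u ⟨hu, hu'⟩
        have hub : b ≤ |u| := by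
          by_contra h
          exact hu' ⟨hu, (le_abs_self u).trans_lt (not_le.1 h)⟩
        simp [planarIntegrand, hm₁, hδ _ _ (hout u hub)]
    · rintro x ⟨hx, hx'⟩
      refine hg0 x ?_
      by_contra h
      exact hx' (hsurj x ⟨hx, (le_abs_self x).trans_lt (not_le.1 h)⟩)

/-- The function `X(u) = u √(2 / (a + √h(u)))`; for `h = a² ± 4u²` it solves the biquadratic
equation `X⁴ ± a X² = ± u²`. -/
noncomputable def biquadraticRoot (a : ℝ) (h : ℝ → ℝ) (u : ℝ) : ℝ :=
  u * √(2 / (a + √(h u)))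

section biquadraticRoot

variable {a : ℝ} {h : ℝ → ℝ}

theorem contDiff_biquadraticRoot (ha : 0 < a) (hh : ContDiff ℝ ∞ h) (hpos : ∀ u, 0 < h u) :
    ContDiff ℝ ∞ (biquadraticRoot a h) := by
  have h1 : ∀ u, 0 < a + √(h u) := fun u => add_pos ha (Real.sqrt_pos.2 (hpos u))
  refine contDiff_id.mul (ContDiff.sqrt ?_ fun u => ?_)
  · exact contDiff_const.div (contDiff_const.add (hh.sqrt fun u => (hpos u).ne'))
      fun u => (h1 u).ne'
  · exact (div_pos two_pos (h1 u)).ne'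

theorem biquadraticRoot_sq (ha : 0 < a) (u : ℝ) :
    biquadraticRoot a h u ^ 2 = u ^ 2 * (2 / (a + √(h u))) := by
  have h1 : 0 < a + √(h u) := by positivity
  rw [biquadraticRoot, mul_pow, Real.sq_sqrt (div_pos two_pos h1).le]

theorem biquadraticRoot_pos (ha : 0 < a) {u : ℝ} (hu : 0 < u) : 0 < biquadraticRoot a h u := by
  have h1 : 0 < a + √(h u) := by positivity
  exact mul_pos hu (Real.sqrt_pos.2 (div_pos two_pos h1))

theorem biquadraticRoot_eq_pos (ha : 0 < a) {u : ℝ} (hu : h u = a ^ 2 + 4 * u ^ 2) :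
    biquadraticRoot a h u ^ 4 + a * biquadraticRoot a h u ^ 2 = 1 * u ^ 2 := by
  have h1 : 0 < a + √(h u) := by positivity
  have h2 : √(h u) ^ 2 = a ^ 2 + 4 * u ^ 2 := by rw [Real.sq_sqrt (by rw [hu]; positivity), hu]
  have h3 : biquadraticRoot a h u ^ 4 = (biquadraticRoot a h u ^ 2) ^ 2 := by ring
  rw [h3, biquadraticRoot_sq ha]
  field_simp
  linear_combination -u ^ 2 * h2

theorem biquadraticRoot_eq_neg (ha : 0 < a) {u : ℝ} (hpos : 0 < h u)
    (hu : h u = a ^ 2 - 4 * u ^ 2) :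
    biquadraticRoot a h u ^ 4 + -a * biquadraticRoot a h u ^ 2 = (-1) * u ^ 2 := by
  have h1 : 0 < a + √(h u) := by positivity
  have h2 : √(h u) ^ 2 = a ^ 2 - 4 * u ^ 2 := by rw [Real.sq_sqrt hpos.le, hu]
  have h3 : biquadraticRoot a h u ^ 4 = (biquadraticRoot a h u ^ 2) ^ 2 := by ring
  rw [h3, biquadraticRoot_sq ha]
  field_simp
  linear_combination u ^ 2 * h2

end biquadraticRoot

/-- Differentiating `X⁴ + t X² = σ u²` gives the sign of `X'`. -/
theorem deriv_nonneg_of_biquadratic {X : ℝ → ℝ} (hX : Differentiable ℝ X) {t σ b : ℝ}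
    (hPX : ∀ u ∈ Set.Ioo 0 b, X u ^ 4 + t * X u ^ 2 = σ * u ^ 2)
    (hpos : ∀ u ∈ Set.Ioo 0 b, 0 < σ * (4 * X u ^ 3 + 2 * t * X u)) :
    ∀ u ∈ Set.Ioo 0 b, 0 ≤ deriv X u := by
  intro u hu
  have hd := (hX u).hasDerivAt
  have h1 := (hd.pow 4).add ((hd.pow 2).const_mul t)
  have h2 : HasDerivAt (fun u : ℝ => σ * u ^ 2) (σ * (2 * u)) u := by
    simpa using (hasDerivAt_pow 2 u).const_mul σ
  have h3 : (X ^ 4 + fun y => t * (X ^ 2) y) =ᶠ[𝓝 u] fun u : ℝ => σ * u ^ 2 := by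
    filter_upwards [Ioo_mem_nhds hu.1 hu.2] with v hv
    simpa using hPX v hv
  have h4 := h1.unique (h2.congr_of_eventuallyEq h3)
  push_cast at h4
  have hσ : σ ≠ 0 := by
    rintro rfl
    have := hpos u hu
    simp at this
  have h5 : σ * (4 * X u ^ 3 + 2 * t * X u) * deriv X u = σ ^ 2 * (2 * u) := by
    simp only [pow_one] at h4
    linear_combination σ * h4
  by_contra hneg
  rw [not_le] at hneg
  have h6 := mul_neg_of_pos_of_neg (hpos u hu) hneg
  have h7 : 0 < σ ^ 2 * (2 * u) := mul_pos (by positivity) (by linarith [hu.1])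
  linarith

theorem exists_planar_subst_pos {t : ℝ} (ht : 0 < t) {m : ℝ × ℝ → ℝ} (hm : ContDiff ℝ ∞ m) {R : ℝ}
    (hR0 : 0 < R) (hR : VanishesOutside R m) :
    ∃ m₁ : ℝ × ℝ → ℝ, ContDiff ℝ ∞ m₁ ∧ (∃ R₁ > 0, VanishesOutside R₁ m₁) ∧
      ∀ l, ∫ x in Set.Ioi (0 : ℝ), ∫ ρ in Set.Ioi (0 : ℝ),
          planarIntegrand (fun z => z.1 ^ 4 + t * z.1 ^ 2 + z.2 ^ 2) m l (x, ρ) =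
        ∫ x in Set.Ioi (0 : ℝ), ∫ ρ in Set.Ioi (0 : ℝ),
          planarIntegrand (fun z => 1 * z.1 ^ 2 + z.2 ^ 2) m₁ l (x, ρ) := by
  set h : ℝ → ℝ := fun u => t ^ 2 + 4 * u ^ 2 with hh
  have hpos : ∀ u, 0 < h u := fun u => by positivity
  set X := biquadraticRoot t h
  have hX : ContDiff ℝ ∞ X := contDiff_biquadraticRoot ht (by fun_prop) hpos
  have hPX : ∀ u, X u ^ 4 + t * X u ^ 2 = 1 * u ^ 2 := fun u => biquadraticRoot_eq_pos ht rfl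
  have hX0 : ∀ u, 0 < u → 0 < X u := fun u hu => biquadraticRoot_pos ht hu
  have hb0 : 0 < R ^ 4 + t * R ^ 2 := by positivity
  -- `x ↦ x⁴ + t x²` is increasing on `x ≥ 0`
  have hmono : ∀ x y : ℝ, x ^ 4 + t * x ^ 2 ≤ y ^ 4 + t * y ^ 2 → x ^ 2 ≤ y ^ 2 := by
    intro x y hxy
    by_contra hlt
    rw [not_le] at hlt
    nlinarith [sq_nonneg x, sq_nonneg y, mul_lt_mul_of_pos_left hlt ht]
  refine exists_planar_subst (P := fun x => x ^ 4 + t * x ^ 2) (b := √(R ^ 4 + t * R ^ 2)) (δ := R)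
    hX one_ne_zero (Real.sqrt_pos.2 hb0) (fun u hu => hX0 u hu.1)
    (deriv_nonneg_of_biquadratic (hX.differentiable (by simp)) (fun u _ => hPX u) fun u hu => ?_)
    (fun u _ => hPX u) ?_ ?_ hm hR (fun x ρ hx => hR x ρ (Or.inl hx))
  · have := hX0 u hu.1
    positivity
  · intro x hx
    have hx0 : 0 < x := hx.1
    have hP0 : 0 < x ^ 4 + t * x ^ 2 := by positivity
    refine ⟨√(x ^ 4 + t * x ^ 2), ⟨Real.sqrt_pos.2 hP0, Real.sqrt_lt_sqrt hP0.le ?_⟩, ?_⟩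
    · have h1 := pow_lt_pow_left₀ hx.2 hx0.le (n := 4) (by norm_num)
      have h2 := pow_lt_pow_left₀ hx.2 hx0.le (n := 2) (by norm_num)
      nlinarith
    · have h1 := hPX √(x ^ 4 + t * x ^ 2)
      rw [Real.sq_sqrt hP0.le, one_mul] at h1
      exact (pow_left_inj₀ (hX0 _ (Real.sqrt_pos.2 hP0)).le hx0.le two_ne_zero).1
        (le_antisymm (hmono _ _ h1.le) (hmono _ _ h1.ge))
  · intro u hu
    have h1 : R ^ 4 + t * R ^ 2 ≤ u ^ 2 := by
      rw [← sq_abs u]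
      exact Real.sqrt_le_left (abs_nonneg u) |>.1 hu
    rw [← one_mul (u ^ 2), ← hPX u] at h1
    have h2 := hmono _ _ h1
    rw [← abs_of_pos hR0]
    exact sq_le_sq.1 h2

theorem exists_planar_subst_neg {k : ℝ} (hk : 0 < k) {m : ℝ × ℝ → ℝ} (hm : ContDiff ℝ ∞ m) {R : ℝ}
    (hR : VanishesOutside R m) (hδ : ∀ x ρ, k / 8 ≤ |x| → m (x, ρ) = 0) :
    ∃ m₁ : ℝ × ℝ → ℝ, ContDiff ℝ ∞ m₁ ∧ (∃ R₁ > 0, VanishesOutside R₁ m₁) ∧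
      ∀ l, ∫ x in Set.Ioi (0 : ℝ), ∫ ρ in Set.Ioi (0 : ℝ),
          planarIntegrand (fun z => z.1 ^ 4 + -k ^ 2 * z.1 ^ 2 + z.2 ^ 2) m l (x, ρ) =
        ∫ x in Set.Ioi (0 : ℝ), ∫ ρ in Set.Ioi (0 : ℝ),
          planarIntegrand (fun z => (-1) * z.1 ^ 2 + z.2 ^ 2) m₁ l (x, ρ) := by
  have hk2 : 0 < k ^ 2 := by positivity
  -- The root `X` is only defined for `|u| ≤ k² / 2`; a cutoff makes it smooth on the whole line.
  let χ : ContDiffBump (0 : ℝ) := ⟨k ^ 2 / 8, k ^ 2 / 4, by positivity, by linarith⟩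
  set h : ℝ → ℝ := fun u => (k ^ 2) ^ 2 - 4 * u ^ 2 * χ u with hh
  have hχ : ∀ u, u ^ 2 * χ u ≤ (k ^ 2 / 4) ^ 2 := by
    intro u
    rcases lt_or_ge |u| (k ^ 2 / 4) with hu | hu
    · have h1 := sq_le_sq' (abs_le.1 hu.le).1 (abs_le.1 hu.le).2
      calc u ^ 2 * χ u ≤ u ^ 2 * 1 := mul_le_mul_of_nonneg_left χ.le_one (sq_nonneg u)
        _ ≤ _ := by linarith
    · have h1 : χ u = 0 := χ.zero_of_le_dist (by simpa using hu)
      rw [h1, mul_zero]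
      positivity
  have hpos : ∀ u, 0 < h u := by
    intro u
    have := hχ u
    simp only [hh]
    nlinarith
  have hle : ∀ u, √(h u) ≤ k ^ 2 := by
    intro u
    refine Real.sqrt_le_iff.2 ⟨hk2.le, ?_⟩
    have : 0 ≤ u ^ 2 * χ u := mul_nonneg (sq_nonneg u) χ.nonneg
    simp only [hh]
    linarith
  set X := biquadraticRoot (k ^ 2) h
  have hX : ContDiff ℝ ∞ X := contDiff_biquadraticRoot hk2
    (contDiff_const.sub ((contDiff_const.mul (contDiff_id.pow 2)).mul χ.contDiff)) hpos
  have hPX : ∀ u ∈ Set.Ioo 0 (k ^ 2 / 8), X u ^ 4 + -k ^ 2 * X u ^ 2 = (-1) * u ^ 2 := by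
    intro u hu
    refine biquadraticRoot_eq_neg hk2 (hpos u) ?_
    have h1 : χ u = 1 := χ.one_of_mem_closedBall (by
      rw [mem_closedBall_zero_iff, Real.norm_of_nonneg hu.1.le]
      exact hu.2.le)
    simp only [hh, h1, mul_one]
  have hX0 : ∀ u, 0 < u → 0 < X u := fun u hu => biquadraticRoot_pos hk2 hu
  have hXle : ∀ u, X u ^ 2 * k ^ 2 ≤ 2 * u ^ 2 := by
    intro u
    have h1 : X u ^ 2 = u ^ 2 * (2 / (k ^ 2 + √(h u))) := biquadraticRoot_sq hk2 u
    have h2 : 2 / (k ^ 2 + √(h u)) ≤ 2 / k ^ 2 :=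
      div_le_div_of_nonneg_left two_pos.le hk2 (by linarith [Real.sqrt_nonneg (h u)])
    calc X u ^ 2 * k ^ 2 ≤ u ^ 2 * (2 / k ^ 2) * k ^ 2 := by
          rw [h1]
          exact mul_le_mul_of_nonneg_right (mul_le_mul_of_nonneg_left h2 (sq_nonneg u)) hk2.le
      _ = 2 * u ^ 2 := by field_simp
  have hXge : ∀ u, u ^ 2 ≤ X u ^ 2 * k ^ 2 := by
    intro u
    have h1 : X u ^ 2 = u ^ 2 * (2 / (k ^ 2 + √(h u))) := biquadraticRoot_sq hk2 u
    have h2 : 2 / (k ^ 2 + k ^ 2) ≤ 2 / (k ^ 2 + √(h u)) :=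
      div_le_div_of_nonneg_left two_pos.le (by positivity) (by linarith [hle u])
    calc u ^ 2 = u ^ 2 * (2 / (k ^ 2 + k ^ 2)) * k ^ 2 := by field_simp; ring
      _ ≤ _ := by
          rw [h1]
          exact mul_le_mul_of_nonneg_right (mul_le_mul_of_nonneg_left h2 (sq_nonneg u)) hk2.le
  refine exists_planar_subst (P := fun x => x ^ 4 + -k ^ 2 * x ^ 2) (b := k ^ 2 / 8) (δ := k / 8)
    hX (by norm_num) (by positivity) (fun u hu => hX0 u hu.1)
    (deriv_nonneg_of_biquadratic (hX.differentiable (by simp)) hPX fun u hu => ?_) hPX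
    ?_ ?_ hm hR hδ
  · have h1 := hX0 u hu.1
    have h2 : X u ^ 2 < k ^ 2 / 2 := by
      have h3 := hXle u
      have h4 : u ^ 2 < (k ^ 2 / 8) ^ 2 := pow_lt_pow_left₀ hu.2 hu.1.le two_ne_zero
      by_contra hcon
      rw [not_lt] at hcon
      nlinarith [mul_le_mul_of_nonneg_right hcon hk2.le]
    have h5 : 0 < X u * (k ^ 2 / 2 - X u ^ 2) := mul_pos h1 (by linarith)
    linarith [show X u * (k ^ 2 / 2 - X u ^ 2) * 4 = -1 * (4 * X u ^ 3 + 2 * -k ^ 2 * X u) by ring]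
  · intro x hx
    have hx0 : 0 < x := hx.1
    have hxk : x ^ 2 < (k / 8) ^ 2 := pow_lt_pow_left₀ hx.2 hx0.le two_ne_zero
    have hx2 : 0 < x ^ 2 := by positivity
    have hP0 : 0 < x ^ 2 * (k ^ 2 - x ^ 2) := mul_pos hx2 (by nlinarith)
    set u := √(x ^ 2 * (k ^ 2 - x ^ 2)) with hu
    have hu2 : u ^ 2 = x ^ 2 * (k ^ 2 - x ^ 2) := Real.sq_sqrt hP0.le
    have hu0 : 0 < u := Real.sqrt_pos.2 hP0
    have hub : u < k ^ 2 / 8 := by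
      refine lt_of_pow_lt_pow_left₀ 2 (by positivity) ?_
      rw [hu2]
      nlinarith [mul_lt_mul_of_pos_right hxk hk2, sq_nonneg (x ^ 2)]
    refine ⟨u, ⟨hu0, hub⟩, ?_⟩
    have h1 := hPX u ⟨hu0, hub⟩
    rw [hu2] at h1
    have h2 := hXle u
    rw [hu2] at h2
    have h3 : X u ^ 2 ≤ 2 * x ^ 2 := by
      refine le_of_mul_le_mul_right (h2.trans ?_) hk2
      nlinarith [sq_nonneg (x ^ 2)]
    have h4 : (X u ^ 2 - x ^ 2) * (X u ^ 2 + x ^ 2 - k ^ 2) = 0 := by linear_combination h1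
    rcases mul_eq_zero.1 h4 with h5 | h5
    · exact (pow_left_inj₀ (hX0 u hu0).le hx0.le two_ne_zero).1 (by linarith)
    · nlinarith
  · intro u hu
    have h1 := hXge u
    have h2 : (k ^ 2 / 8) ^ 2 ≤ u ^ 2 := by
      rw [← sq_abs u]
      exact pow_le_pow_left₀ (by positivity) hu 2
    have h3 : (k / 8) ^ 2 ≤ X u ^ 2 := by
      refine le_of_mul_le_mul_right ?_ hk2
      nlinarith
    rw [← abs_of_pos (show 0 < k / 8 by positivity)]
    exact sq_le_sq.1 h3

/-! ### The three oscillation indices -/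

/-- There are arbitrarily large orders `M` that avoid the exponents in `ℤ / 8`. -/
theorem exists_order_gt (A : ℝ) : ∃ M, A < M ∧ ∀ q : ℕ, q ∣ 8 → ∀ k : ℕ, ((k + 1 : ℝ) / q) ≠ M := by
  obtain ⟨n, hn⟩ := exists_nat_gt A
  refine ⟨n + 1 / 16, by linarith, fun q ⟨d, hd⟩ k h => ?_⟩
  have hq : q ≠ 0 := by
    rintro rfl
    simp at hd
  have hq' : (q : ℝ) ≠ 0 := by exact_mod_cast hq
  have hd' : (8 : ℝ) = q * d := by exact_mod_cast hd
  rw [div_eq_iff hq'] at h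
  have h1 : (2 * ((k + 1) * d) : ℝ) = 16 * n + 1 := by
    linear_combination 2 * (d : ℝ) * h - (2 * n + 1 / 8) * hd'
  have h2 : 2 * ((k + 1) * d) = 16 * n + 1 := by exact_mod_cast h1
  omega

theorem stepMult_le_one (q s : ℕ) (b : ℝ) : stepMult q s b ≤ 1 := by
  unfold stepMult
  split_ifs <;> omega

theorem exists_of_stepMult_pos {q s : ℕ} {b : ℝ} (h : 0 < stepMult q s b) :
    ∃ j : ℕ, b = (s + j + 1) / q := by
  unfold stepMult at h
  split_ifs at h with h1
  · obtain ⟨k, hk, rfl⟩ := h1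
    refine ⟨k - s, ?_⟩
    rw [Nat.cast_sub hk]
    ring
  · omega

theorem isOscillationIndex_phaseV_pos {t : ℝ} (ht : 0 < t) :
    IsOscillationIndex (phaseV t) (3 / 4) := by
  have := isOscillationIndex_of_expandsUpTo (S := phaseV t) (β := 3 / 4) (e := 1 / 4) (by norm_num)
    (by norm_num) (U₀ := Set.univ) univ_mem (m := stepMult 4 2) ?_ ?_ ?_
  · simpa using this
  · intro b hb
    obtain ⟨j, rfl⟩ := exists_of_stepMult_pos hb
    refine ⟨(stepMult_le_one _ _ _).trans (by norm_num), j, ?_⟩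
    push_cast
    ring
  · intro φ hφ A
    obtain ⟨m, hm, ⟨R, hR0, hR⟩, -, hJ⟩ := exists_planar_reduction
      (P := fun x => x ^ 4 + t * x ^ 2) (by fun_prop) (fun x => by ring) hφ.1 hφ.2.1
    obtain ⟨m₁, hm₁, ⟨R₁, hR₁0, hR₁⟩, hJ₁⟩ := exists_planar_subst_pos ht hm hR0 hR
    obtain ⟨R₂, G, hG, hJ₂⟩ := exists_monoInt_definite (κ := 1) le_rfl Real.contDiff_cos
      (fun w hw => Real.cos_pos_of_mem_Ioo ⟨by linarith [hw.1, Real.pi_pos], hw.2⟩)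
      (fun w => by simp) hm₁ hR₁0 hR₁
    obtain ⟨M, hAM, hM⟩ := exists_order_gt A
    refine ⟨M, hAM, ?_⟩
    have h1 := expandsUpTo_monoInt_zero (q := 4) (by norm_num) 0 (Real.pi / 2) R₂
      (hM 4 (by norm_num)) 2 hG
    convert h1 using 1
    funext l
    refine (hJ l).trans ((hJ₁ l).trans ?_)
    simp only [one_mul]
    exact hJ₂ l
  · intro U hU _
    have h1 := exists_isAmplitude_not_isLittleO (by norm_num) (sublevel_of_pos ht) hU
    simpa using h1

theorem isOscillationIndex_phaseV_zero : IsOscillationIndex (phaseV 0) (5 / 8) := by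
  have := isOscillationIndex_of_expandsUpTo (S := phaseV 0) (β := 5 / 8) (e := 1 / 8) (by norm_num)
    (by norm_num) (U₀ := Set.univ) univ_mem (m := stepMult 8 4) ?_ ?_ ?_
  · simpa using this
  · intro b hb
    obtain ⟨j, rfl⟩ := exists_of_stepMult_pos hb
    refine ⟨(stepMult_le_one _ _ _).trans (by norm_num), j, ?_⟩
    push_cast
    ring
  · intro φ hφ A
    obtain ⟨m, hm, ⟨R, hR0, hR⟩, -, hJ⟩ := exists_planar_reduction
      (P := fun x => x ^ 4 + 0 * x ^ 2) (by fun_prop) (fun x => by ring) hφ.1 hφ.2.1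
    have hs : ∀ w : ℝ, 0 < 1 + Real.sin w ^ 2 := fun w => by positivity
    obtain ⟨R₂, G, hG, hJ₂⟩ := exists_monoInt_definite (κ := 2) (by norm_num)
      (B := fun w => Real.cos w * √(1 + Real.sin w ^ 2))
      (Real.contDiff_cos.mul ((contDiff_const.add (Real.contDiff_sin.pow 2)).sqrt
        fun w => (hs w).ne'))
      (fun w hw => mul_pos (Real.cos_pos_of_mem_Ioo ⟨by linarith [hw.1, Real.pi_pos], hw.2⟩)
        (Real.sqrt_pos.2 (hs w)))
      (fun w => by
        rw [mul_pow, Real.sq_sqrt (hs w).le, Real.cos_sq']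
        ring) hm hR0 hR
    obtain ⟨M, hAM, hM⟩ := exists_order_gt A
    refine ⟨M, hAM, ?_⟩
    have h1 := expandsUpTo_monoInt_zero (q := 8) (by norm_num) 0 (Real.pi / 2) R₂
      (hM 8 (by norm_num)) 4 hG
    convert h1 using 1
    funext l
    refine (hJ l).trans ?_
    simp only [zero_mul, add_zero]
    exact hJ₂ l
  · intro U hU _
    have h1 := exists_isAmplitude_not_isLittleO (by norm_num) sublevel_zero hU
    simpa using h1

theorem isOscillationIndex_phaseV_neg {t : ℝ} (ht : t < 0) :
    IsOscillationIndex (phaseV t) (1 / 2) := by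
  obtain ⟨k, hk, rfl⟩ : ∃ k : ℝ, 0 < k ∧ t = -k ^ 2 :=
    ⟨√(-t), Real.sqrt_pos.2 (by linarith), by rw [Real.sq_sqrt (by linarith)]; ring⟩
  have hU₀ : {p : Fin 3 → ℝ | |p 0| < k / 8} ∈ 𝓝 (0 : Fin 3 → ℝ) := by
    refine IsOpen.mem_nhds (isOpen_lt (by fun_prop) continuous_const) ?_
    simpa using hk
  have := isOscillationIndex_of_expandsUpTo (S := phaseV (-k ^ 2)) (β := 1 / 2) (e := 1 / 4)
    (by norm_num) (by norm_num) hU₀ (m := stepMult 4 2 + stepMult 2 0) ?_ ?_ ?_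
  · simpa using this
  · intro b hb
    have h1 := stepMult_le_one 4 2 b
    have h2 := stepMult_le_one 2 0 b
    refine ⟨?_, ?_⟩
    · simp only [Pi.add_apply]
      omega
    · rcases Nat.add_pos_iff_pos_or_pos.1 hb with h3 | h3
      · obtain ⟨j, rfl⟩ := exists_of_stepMult_pos h3
        refine ⟨j + 1, ?_⟩
        push_cast
        ring
      · obtain ⟨j, rfl⟩ := exists_of_stepMult_pos h3
        refine ⟨2 * j, ?_⟩
        push_cast
        ring
  · intro φ hφ A
    obtain ⟨m, hm, ⟨R, hR0, hR⟩, hδ, hJ⟩ := exists_planar_reduction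
      (P := fun x => x ^ 4 + -k ^ 2 * x ^ 2) (by fun_prop) (fun x => by ring) hφ.1 hφ.2.1
    have hφδ : ∀ p : Fin 3 → ℝ, k / 8 ≤ |p 0| → φ p = 0 := by
      intro p hp
      by_contra hne
      have h1 : |p 0| < k / 8 := hφ.2.2 (subset_tsupport _ hne)
      linarith
    obtain ⟨m₁, hm₁, ⟨R₁, hR₁0, hR₁⟩, hJ₁⟩ := exists_planar_subst_neg hk hm hR (hδ _ hφδ)
    obtain ⟨R₂, G, hG, hJ₂⟩ := exists_monoInt_indefinite hm₁ hR₁0 hR₁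
    obtain ⟨M, hAM, hM⟩ := exists_order_gt A
    refine ⟨M, hAM, ?_⟩
    have h1 := expandsUpTo_monoInt (p := 2) (q := 4) (by norm_num) even_two (by norm_num) R₂
      (hM 4 (by norm_num)) (hM 2 (by norm_num)) 2 hG
    convert h1 using 1
    funext l
    refine (hJ l).trans ((hJ₁ l).trans ?_)
    simp only [neg_one_mul]
    exact hJ₂ l
  · intro U hU _
    have h1 := exists_isAmplitude_not_isLittleO (by norm_num) (sublevel_of_neg ht) hU
    simpa using h1

theorem theorem1p8 :
    (∀ t : ℝ, 0 < t → IsOscillationIndex (phaseV t) (3 / 4)) ∧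
    IsOscillationIndex (phaseV 0) (5 / 8) ∧
    (∀ t : ℝ, t < 0 → IsOscillationIndex (phaseV t) (1 / 2)) :=
  ⟨fun _ ht => isOscillationIndex_phaseV_pos ht, isOscillationIndex_phaseV_zero,
    fun _ ht => isOscillationIndex_phaseV_neg ht⟩
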